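/- \textbf{Setting.} A \emph{unimodular lattice} $\Lambda\subset\mathbb{R}^n$ is a lattice of full rank with $\langle x,y\rangle\in\mathbb{Z}$ for all $x,y\in\Lambda$ and with determinant (of the Gram matrix of a basis) $\pm1$; it is \emph{odd} if $\|x\|^2$ is odd for some $x\in\Lambda$. The \emph{length} of a vector $x$ is $\|x\|^2$, and the shortest vector length of $\Lambda$ is the least length of a nonzero vector of $\Lambda$. Let $\Theta_\Lambda(\tau)=\sum_{x\in\Lambda}e^{\pi i\|x\|^2\tau}$. The secrecy function of $\Lambda$ is $\Xi_\Lambda(y)=\Theta_{\mathbb{Z}^n}(yi)/\Theta_\Lambda(yi)$ for $y>0$, and its secrecy gain is $\chi_\Lambda=\max_{y>0}\Xi_\Lambda(y)$. The conjecture of Belfiore and Sol\'e for $\Lambda$ says that $\Xi_\Lambda$ attains its maximum over $y>0$ at $y=1$. \textbf{Theorem.} Let $\Lambda$ and $\Lambda'$ be odd unimodular lattices in dimension $n$, both with shortest vector length $\left\lfloor\frac n8\right\rfloor$, and let $h$ and $h'$ be the numbers of vectors of length $\left\lfloor\frac n8\right\rfloor$ in $\Lambda$ and $\Lambda'$, respectively.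 Then the maxima defining $\chi_\Lambda$ and $\chi_{\Lambda'}$ exist, and the secrecy gain increases as the number of shortest vectors decreases: if $h'<h$, then $\chi_\Lambda<\chi_{\Lambda'}$. Furthermore, if the conjecture of Belfiore and Sol\'e holds for $\Lambda$ and for $\Lambda'$, then \[ \frac1{\chi_\Lambda}-\frac1{\chi_{\Lambda'}}=\frac{h-h'}{4^{3\lfloor n/8\rfloor}}. \] -/

import Mathlib

namespace SecrecyGain

/-- Euclidean `n`-space. -/
abbrev Space (n : ℕ) : Type := EuclideanSpace ℝ (Fin n)

/-- The lattice `ℤⁿ`: the `ℤ`-span of the standard basis of `ℝⁿ`. -/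
noncomputable def cubicLattice (n : ℕ) : Submodule ℤ (Space n) :=
  Submodule.span ℤ (Set.range (EuclideanSpace.basisFun (Fin n) ℝ))

/-- The theta series `Θ_Λ(τ) = ∑_{x ∈ Λ} exp(π i ‖x‖² τ)`. -/
noncomputable def theta {n : ℕ} (Λ : Submodule ℤ (Space n)) (τ : ℂ) : ℂ :=
  ∑' x : Λ, Complex.exp (Real.pi * Complex.I * ((‖(x : Space n)‖ ^ 2 : ℝ) : ℂ) * τ)

/-- On the imaginary axis the theta series is real. -/
theorem theta_mul_I {n : ℕ} (Λ : Submodule ℤ (Space n)) (y : ℝ) :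
    theta Λ (y * Complex.I) =
      ((∑' x : Λ, Real.exp (-(Real.pi * ‖(x : Space n)‖ ^ 2 * y)) : ℝ) : ℂ) := by
  rw [theta, Complex.ofReal_tsum]
  refine tsum_congr fun x => ?_
  rw [Complex.ofReal_exp]
  congr 1
  push_cast
  linear_combination
    ((Real.pi : ℂ) * ((‖(x : Space n)‖ : ℝ) : ℂ) ^ 2 * y) * Complex.I_mul_I

/-- The secrecy function `Ξ_Λ(y) = Θ_{ℤⁿ}(yi) / Θ_Λ(yi)`. Both theta values are real
by `theta_mul_I`, so taking the real part only changes the type. -/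
noncomputable def secrecyFunction {n : ℕ} (Λ : Submodule ℤ (Space n)) (y : ℝ) : ℝ :=
  (theta (cubicLattice n) (y * Complex.I) / theta Λ (y * Complex.I)).re

/-- The secrecy gain, the supremum of the secrecy function over `y > 0`. (That it is a maximum
is expressed by `IsGreatest (secrecyFunction Λ '' Set.Ioi 0) (secrecyGain Λ)`.) -/
noncomputable def secrecyGain {n : ℕ} (Λ : Submodule ℤ (Space n)) : ℝ :=
  sSup (secrecyFunction Λ '' Set.Ioi 0)

/-- The Belfiore–Solé conjecture for the lattice `Λ`: on `y > 0` the secrecy function of `Λ`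
attains its maximum at `y = 1`. -/
def BelfioreSole {n : ℕ} (Λ : Submodule ℤ (Space n)) : Prop :=
  IsMaxOn (secrecyFunction Λ) (Set.Ioi 0) 1

/-- A unimodular lattice: all inner products are integers and the determinant of the Gram matrix
of a `ℤ`-basis is `±1` (this determinant does not depend on the basis). -/
structure IsUnimodular {n : ℕ} (Λ : Submodule ℤ (Space n)) : Prop where
  integral : ∀ x ∈ Λ, ∀ y ∈ Λ, ∃ k : ℤ, inner ℝ x y = (k : ℝ)
  det_gram : ∃ b : Module.Basis (Fin n) ℤ Λ,
    |(Matrix.of fun i j : Fin n => inner ℝ (b i : Space n) (b j : Space n)).det| = 1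

/-- A lattice is even if `‖x‖²` is an even integer for all its vectors `x`. -/
def IsEvenLattice {n : ℕ} (Λ : Submodule ℤ (Space n)) : Prop :=
  ∀ x ∈ Λ, ∃ k : ℤ, ‖x‖ ^ 2 = 2 * (k : ℝ)

/-- An odd unimodular lattice: unimodular and not even. -/
structure IsOddUnimodular {n : ℕ} (Λ : Submodule ℤ (Space n)) : Prop where
  unimodular : IsUnimodular Λ
  not_even : ¬ IsEvenLattice Λ

/-- The length of a vector is `‖x‖²`; `m` is the shortest vector length of `Λ` if it is the
least length of a nonzero vector of `Λ`. -/
def IsShortestLength {n : ℕ} (Λ : Submodule ℤ (Space n)) (m : ℕ) : Prop :=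
  IsLeast {r : ℝ | ∃ x ∈ Λ, x ≠ 0 ∧ ‖x‖ ^ 2 = r} (m : ℝ)

/-- The number of vectors of length `m` in `Λ`. -/
noncomputable def numVectors {n : ℕ} (Λ : Submodule ℤ (Space n)) (m : ℕ) : ℕ :=
  {x : Space n | x ∈ Λ ∧ ‖x‖ ^ 2 = (m : ℝ)}.ncard

end SecrecyGain

/-! Put m = ⌊n/8⌋ and q = exp(πiz). By Poisson summation (`IsUnimodular.tsum_gaussian`) the theta
series of a unimodular lattice transforms under the theta group, generated by z ↦ z + 2 and z ↦
-1/z, like θ₃ⁿ. A function of this type with moderate growth at the real line that is O(q^k) at i∞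
with n < 8k is zero (`IsThetaForm.eq_zero`). Both theta series begin with 1 plus the number of
shortest vectors times q^m, and θ₃^(n-8m) Δ₈^m with Δ₈ = θ₂⁴θ₄⁴/16 begins with q^m. Since n <
8(m+1), it follows (`IsUnimodular.theta_sub_theta`) that Θ_Λ - Θ_Λ' = (h - h') θ₃^(n-8m) Δ₈^m.

On the imaginary axis the last product is positive. So h' < h makes Ξ_Λ smaller than Ξ_Λ' at every
point, in particular at a maximiser of Ξ_Λ. At z = i, Jacobi's identity and θ₂(i) = θ₄(i) give Δ₈(i)
= θ₃(i)⁸/64; dividing by Θ_{ℤⁿ}(i) = θ₃(i)ⁿ yields the difference (h - h')/64^m of the reciprocals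
of the secrecy functions at y = 1.

The vanishing criterion uses a norm. The eighth power of the form has trivial multiplier, and the
product of its three conjugates is a modular form of level one. Divided by a power of the
discriminant Δ it has weight zero and still vanishes at the cusp, so it is zero.

The maxima exist because Ξ is continuous, invariant under y ↦ 1/y, tends to 1 at infinity, and takes
some value ≥ 1 (`IsUnimodular.exists_one_le_secrecyFunction`). -/

namespace SecrecyGain

/-! ### Vanishing criterion for the theta group -/

section

open Complex Filter Asymptotics ModularForm
open UpperHalfPlane hiding I re_add_im
open scoped MatrixGroups Real Topology Manifold

/-- A holomorphic function on the upper half plane that transforms like a modular form of level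
one and weight `12 w`, and vanishes at `i∞` to order larger than `w`, is zero. -/
theorem levelOne_eq_zero (w : ℕ) {N : ℂ → ℂ} (hN : DifferentiableOn ℂ N {z | 0 < z.im})
    (hT : ∀ z : ℂ, 0 < z.im → N (z + 1) = N z)
    (hS : ∀ z : ℂ, 0 < z.im → N (-1 / z) = z ^ (12 * w) * N z)
    (hinf : N =o[comap Complex.im atTop] fun z => Real.exp (-2 * π * z.im) ^ w)
    {z : ℂ} (hz : 0 < z.im) : N z = 0 := by
  -- Δ has weight 12 and no zeros, so the quotient is holomorphic of weight 0.
  let g : ℍ → ℂ := fun τ => N τ / discriminant τ ^ w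
  have hgS : g ∣[(0 : ℤ)] ModularGroup.S = g := by
    funext τ
    have h1 := congrFun discriminant_S_invariant τ
    have hτ : (τ : ℂ) ≠ 0 := τ.ne_zero
    rw [SL_slash_apply] at h1 ⊢
    rw [ModularGroup.denom_S] at h1
    have h2 : discriminant (ModularGroup.S • τ) = (τ : ℂ) ^ 12 * discriminant τ := by
      rw [zpow_neg, ← div_eq_mul_inv, div_eq_iff (zpow_ne_zero _ hτ), zpow_ofNat, mul_comm] at h1
      exact h1
    have h3 : ((ModularGroup.S • τ : ℍ) : ℂ) = -1 / τ := by
      rw [modular_S_smul, coe_mk, inv_neg, neg_div, one_div]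
    simp only [g]
    rw [neg_zero, zpow_zero, mul_one, h3, h2, hS τ τ.2, mul_pow, ← pow_mul,
      mul_div_mul_left _ _ (pow_ne_zero _ hτ)]
  have hgT : g ∣[(0 : ℤ)] ModularGroup.T = g := by
    funext τ
    have h1 := congrFun discriminant_T_invariant τ
    have hd : denom (ModularGroup.T : GL (Fin 2) ℝ) τ = 1 := by
      rw [ModularGroup.denom_apply]; simp [ModularGroup.T]
    rw [SL_slash_apply, hd, one_zpow, mul_one] at h1 ⊢
    have h3 : ((ModularGroup.T • τ : ℍ) : ℂ) = τ + 1 := by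
      rw [modular_T_smul, coe_vadd, add_comm, ofReal_one]
    simp only [g]
    rw [h1, h3, hT τ τ.2]
  -- Δ is bounded below by a multiple of exp(-2π Im τ) near i∞, so N is o(Δ^w).
  have hg0 : IsZeroAtImInfty g := by
    have h1 : (fun τ : ℍ => N τ) =o[atImInfty] fun τ : ℍ => Real.exp (-2 * π * τ.im) ^ w :=
      hinf.comp_tendsto tendsto_coe_atImInfty
    have h2 : (fun τ : ℍ => Real.exp (-2 * π * τ.im) ^ w) =O[atImInfty]
        fun τ => discriminant τ ^ w := exp_isBigO_discriminant.pow w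
    exact (h1.trans_isBigO h2).tendsto_div_nhds_zero
  let f : ModularForm 𝒮ℒ 0 :=
    { toFun := g
      slash_action_eq' := fun _ ⟨γ, hγ⟩ =>
        hγ ▸ SlashInvariantForm.slash_action_generators_SL2Z hgS hgT γ
      holo' := by
        rw [UpperHalfPlane.mdifferentiable_iff]
        have hΔ := UpperHalfPlane.mdifferentiable_iff.mp CuspForm.discriminant.holo'
        refine DifferentiableOn.congr (hN.div (hΔ.pow w) ?_) ?_
        · intro x hx
          exact pow_ne_zero _ (discriminant_ne_zero _)
        · intro x hx
          simp only [Function.comp_apply, g, Pi.div_apply, Pi.pow_apply]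
          rw [ofComplex_apply_of_im_pos hx]
          rfl
      bdd_at_cusps' := fun {c} hc => by
        rw [Subgroup.IsArithmetic.isCusp_iff_isCusp_SL2Z] at hc
        rw [OnePoint.isBoundedAt_iff_forall_SL2Z hc]
        intro γ _
        rw [SlashInvariantForm.slash_action_generators_SL2Z hgS hgT γ]
        exact hg0.boundedAtFilter }
  obtain ⟨c, hc⟩ := ModularFormClass.levelOne_weight_zero_const f
  have hgc : g = Function.const _ c := hc
  have hc0 : c = 0 := by
    rw [hgc] at hg0
    exact tendsto_nhds_unique tendsto_const_nhds hg0
  have := congrFun hgc ⟨z, hz⟩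
  simp only [g, hc0, Function.const_apply, div_eq_zero_iff] at this
  exact this.resolve_right (pow_ne_zero _ (discriminant_ne_zero _))

theorem im_neg_one_div (z : ℂ) : (-1 / z).im = z.im / normSq z := by
  rw [neg_div, one_div, neg_im, inv_im, neg_div, neg_neg]

theorem im_neg_one_div_pos {z : ℂ} (hz : 0 < z.im) : 0 < (-1 / z).im := by
  rw [im_neg_one_div]
  exact div_pos hz (normSq_pos.2 fun h => by simp [h] at hz)

theorem ne_zero_of_im_pos {z : ℂ} (hz : 0 < z.im) : z ≠ 0 := fun h => by simp [h] at hz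

theorem eventually_im_ge (c : ℝ) : ∀ᶠ z : ℂ in comap Complex.im atTop, c ≤ z.im :=
  tendsto_comap.eventually (eventually_ge_atTop c)

/-- The third factor of the norm from the theta group to the modular group. -/
theorem thetaGroup_conj_periodic {w : ℕ} {F : ℂ → ℂ}
    (hT : ∀ z : ℂ, 0 < z.im → F (z + 2) = F z)
    (hS : ∀ z : ℂ, 0 < z.im → F (-1 / z) = z ^ (4 * w) * F z) {z : ℂ} (hz : 0 < z.im) :
    F (1 + -1 / (z + 1)) / (z + 1) ^ (4 * w) = F (1 + -1 / z) / z ^ (4 * w) := by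
  have hz0 := ne_zero_of_im_pos hz
  have hz1 : 0 < (z + 1).im := by simpa using hz
  have hz10 := ne_zero_of_im_pos hz1
  have hu : 0 < (-1 + -1 / z).im := by simpa using im_neg_one_div_pos hz
  have hu0 := ne_zero_of_im_pos hu
  -- Translation by 2 replaces 1 - 1/z by -1 - 1/z, which z ↦ -1/z sends to 1 - 1/(z+1).
  have h1 : F (1 + -1 / z) = F (-1 + -1 / z) := by
    rw [← hT _ hu]; ring_nf
  have h2 := hS _ hu
  have h3 : -1 / (-1 + -1 / z) = 1 + -1 / (z + 1) := by
    have : -1 + -1 / z = -(z + 1) / z := by field_simp; ring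
    rw [this]; field_simp; ring
  have h4 : -1 + -1 / z = -((z + 1) / z) := by field_simp; ring
  rw [h3] at h2
  rw [h2, h1, h4, (even_iff_two_dvd.2 ⟨2 * w, by ring⟩ : Even (4 * w)).neg_pow, div_pow]
  field_simp

/-- Boundedness at the second cusp of the theta group. By periodicity the real part may be taken in
[0,1); the imaginary part of 1 - 1/z is then Im z/|z|² ≤ 1, so moderate growth bounds the quotient
by C(|z|/Im z)^(4w), and |z| ≤ 2 Im z. -/
theorem thetaGroup_conj_isBigO {w : ℕ} {F : ℂ → ℂ}
    (hT : ∀ z : ℂ, 0 < z.im → F (z + 2) = F z)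
    (hS : ∀ z : ℂ, 0 < z.im → F (-1 / z) = z ^ (4 * w) * F z)
    {C : ℝ} (hC : ∀ z : ℂ, 0 < z.im → z.im ≤ 1 → ‖F z‖ ≤ C * z.im⁻¹ ^ (4 * w)) :
    (fun z => F (1 + -1 / z) / z ^ (4 * w)) =O[comap Complex.im atTop] fun _ => (1 : ℝ) := by
  refine IsBigO.of_bound (C * 2 ^ (4 * w)) ?_
  filter_upwards [eventually_im_ge 1] with z hz
  have hz0 : 0 < z.im := by linarith
  have hper : Function.Periodic
      (fun x : ℝ => F (1 + -1 / (x + z.im * I)) / (x + z.im * I) ^ (4 * w)) 1 := by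
    intro x
    have := thetaGroup_conj_periodic hT hS (z := x + z.im * I) (by simpa using hz0)
    simp only [ofReal_add, ofReal_one]
    rw [← this, add_right_comm]
  obtain ⟨x, ⟨hx0, hx1⟩, hx⟩ := hper.exists_mem_Ico₀ one_pos z.re
  simp only [re_add_im] at hx
  rw [hx]
  have hu : 0 < ((x : ℂ) + z.im * I).im := by simpa using hz0
  have huim : ((x : ℂ) + z.im * I).im = z.im := by simp
  have hN : normSq ((x : ℂ) + z.im * I) = x ^ 2 + z.im ^ 2 := by
    simp [normSq_apply]; ring
  have hle : z.im / (x ^ 2 + z.im ^ 2) ≤ 1 := by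
    rw [div_le_one (by positivity)]; nlinarith
  have h := hC (1 + -1 / (x + z.im * I)) (by simpa using im_neg_one_div_pos hu)
    (by rw [add_im, one_im, zero_add, im_neg_one_div, huim, hN]; exact hle)
  have hC0 : 0 ≤ C := by
    have := (norm_nonneg _).trans (hC I (by simp) (by simp))
    simpa using this
  rw [add_im, one_im, zero_add, im_neg_one_div, huim, hN, inv_div] at h
  have hn : ‖(x : ℂ) + z.im * I‖ ^ 2 = x ^ 2 + z.im ^ 2 := by rw [← normSq_eq_norm_sq, hN]
  have hn0 : 0 < ‖(x : ℂ) + z.im * I‖ := norm_pos_iff.2 (ne_zero_of_im_pos hu)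
  have hn2 : ‖(x : ℂ) + z.im * I‖ ≤ 2 * z.im := by
    refine abs_le_of_sq_le_sq' ?_ (by positivity) |>.2
    rw [hn]; nlinarith
  rw [norm_div, norm_pow, norm_one, mul_one, div_le_iff₀ (by positivity), mul_assoc, ← mul_pow]
  refine h.trans ?_
  gcongr
  rw [← hn, div_le_iff₀ hz0]
  nlinarith

/-- A holomorphic function on the upper half plane that transforms under the theta group like a
modular form of weight `4 w`, has moderate growth at the real line, and vanishes at `i∞` to order
larger than `w`, is zero. -/
theorem thetaGroup_eq_zero {w k : ℕ} (hk : w < k) {F : ℂ → ℂ}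
    (hF : DifferentiableOn ℂ F {z | 0 < z.im})
    (hT : ∀ z : ℂ, 0 < z.im → F (z + 2) = F z)
    (hS : ∀ z : ℂ, 0 < z.im → F (-1 / z) = z ^ (4 * w) * F z)
    {C : ℝ} (hC : ∀ z : ℂ, 0 < z.im → z.im ≤ 1 → ‖F z‖ ≤ C * z.im⁻¹ ^ (4 * w))
    (hinf : F =O[comap Complex.im atTop] fun z => Real.exp (-π * z.im) ^ k)
    {z : ℂ} (hz : 0 < z.im) : F z = 0 := by
  set U : Set ℂ := {z | 0 < z.im} with hU
  have hUo : IsOpen U := isOpen_lt continuous_const Complex.continuous_im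
  have hUc : IsPreconnected U := (convex_halfSpace_im_gt 0).isPreconnected
  -- F, F₁ and F₂ are the conjugates of F for the three cosets of the theta group in the modular
  -- group. Translation by 1 swaps F and F₁ and fixes F₂; inversion fixes F and swaps F₁ and F₂, up
  -- to factors z^(4w).
  set F₁ : ℂ → ℂ := fun z => F (z + 1) with hF₁
  set F₂ : ℂ → ℂ := fun z => F (1 + -1 / z) / z ^ (4 * w) with hF₂
  have hd₁ : DifferentiableOn ℂ F₁ U :=
    hF.comp (by fun_prop) fun z hz => by simpa [hU] using hz
  have hd₂ : DifferentiableOn ℂ F₂ U := by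
    refine DifferentiableOn.div (hF.comp ?_ ?_) (by fun_prop) ?_
    · refine DifferentiableOn.const_add _ (DifferentiableOn.div (by fun_prop) (by fun_prop) ?_)
      exact fun z hz => ne_zero_of_im_pos hz
    · exact fun z hz => by simpa [hU] using im_neg_one_div_pos hz
    · exact fun z hz => pow_ne_zero _ (ne_zero_of_im_pos hz)
  have hN : ∀ z ∈ U, (F z * F₁ z) * F₂ z = 0 := by
    intro z hz
    refine levelOne_eq_zero w (N := fun z => (F z * F₁ z) * F₂ z) ((hF.mul hd₁).mul hd₂)
      ?_ ?_ ?_ hz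
    · intro z hz
      have h1 : F (z + 1 + 1) = F z := by rw [← hT z hz]; ring_nf
      have h2 : F₂ (z + 1) = F₂ z := thetaGroup_conj_periodic hT hS hz
      simp only [h2]
      simp only [hF₁, h1]
      ring
    · intro z hz
      have hz0 := ne_zero_of_im_pos hz
      have h1 : F₁ (-1 / z) = z ^ (4 * w) * F₂ z := by
        simp only [hF₁, hF₂, add_comm (-1 / z)]
        field_simp
      have h2 : F₂ (-1 / z) = z ^ (4 * w) * F₁ z := by
        simp only [hF₁, hF₂]
        have : 1 + -1 / (-1 / z) = z + 1 := by field_simp; ring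
        rw [this, div_pow, (even_iff_two_dvd.2 ⟨2 * w, by ring⟩ : Even (4 * w)).neg_pow, one_pow,
          div_div_eq_mul_div, div_one, mul_comm]
      simp only [h1, h2, hS z hz]
      ring
    · have h1 : F₁ =O[comap Complex.im atTop] fun z => Real.exp (-π * z.im) ^ k := by
        have ht : Tendsto (fun z : ℂ => z + 1) (comap Complex.im atTop)
            (comap Complex.im atTop) := by
          rw [tendsto_comap_iff]
          have : Complex.im ∘ (fun z : ℂ => z + 1) = Complex.im := by ext; simp
          rw [this]
          exact tendsto_comap
        simpa [Function.comp_def] using hinf.comp_tendsto ht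
      have h2 := (hinf.mul h1).mul (thetaGroup_conj_isBigO hT hS hC)
      refine h2.trans_isLittleO ?_
      -- F and F₁ each decay like |q|^k and F₂ is bounded; together this is the k-th power of |q²|,
      -- the size of the local parameter at level one.
      have h3 : ∀ z : ℂ, Real.exp (-π * z.im) ^ k * Real.exp (-π * z.im) ^ k * 1
          = Real.exp (-2 * π * z.im) ^ k := by
        intro z
        rw [mul_one, ← mul_pow, ← Real.exp_add]; ring_nf
      simp only [h3]
      have h4 : Tendsto (fun z : ℂ => Real.exp (-2 * π * z.im)) (comap Complex.im atTop)
          (𝓝 0) := by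
        refine Real.tendsto_exp_atBot.comp ?_
        exact tendsto_comap.const_mul_atTop_of_neg (by linarith [Real.pi_pos])
      exact (isLittleO_pow_pow hk).comp_tendsto h4
  -- Analytic functions on a connected domain have no zero divisors, so one conjugate vanishes
  -- identically; undoing the substitution gives F = 0.
  have key := fun (f g : ℂ → ℂ) (hf : DifferentiableOn ℂ f U) (hg : DifferentiableOn ℂ g U)
      (h : ∀ z ∈ U, f z * g z = 0) =>
    AnalyticOnNhd.eq_zero_or_eq_zero_of_mul_eq_zero (hf.analyticOnNhd hUo) (hg.analyticOnNhd hUo)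
      h hUc
  rcases key _ _ (hF.mul hd₁) hd₂ hN with h | h
  · rcases key _ _ hF hd₁ h with h | h
    · exact h z hz
    · have := h (z - 1) (by simpa [hU] using hz)
      simpa [hF₁] using this
  · have hz1 : 0 < (z - 1).im := by simpa using hz
    have := h (-1 / (z - 1)) (im_neg_one_div_pos hz1)
    have hz10 := ne_zero_of_im_pos hz1
    simp only [hF₂, div_eq_zero_iff] at this
    have h2 := this.resolve_right (pow_ne_zero _ (div_ne_zero (by simp) hz10))
    have h3 : 1 + -1 / (-1 / (z - 1)) = z := by field_simp; ring
    rwa [h3] at h2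

end

/-! ### Poisson summation for unimodular lattices -/

section

open Topology Complex Filter Asymptotics MeasureTheory
open scoped Real Topology

variable {n : ℕ}

theorem summable_exp_neg_mul_norm_sq (Λ : Submodule ℤ (Space n)) [DiscreteTopology Λ]
    [IsZLattice ℝ Λ] {c : ℝ} (hc : 0 < c) :
    Summable fun x : Λ => Real.exp (-(c * ‖(x : Space n)‖ ^ 2)) := by
  -- The sum of ‖x‖^(-2N) converges since 2N exceeds the rank, and e^t ≥ t^N/N! bounds the Gaussian
  -- by it away from x = 0.
  set N := Module.finrank ℤ Λ + 1
  have hs : Summable fun x : Λ => (‖x‖⁻¹) ^ (2 * N) :=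
    ZLattice.summable_norm_pow_inv Λ (2 * N) (by omega)
  refine Summable.of_norm_bounded_eventually (hs.mul_left (N.factorial / c ^ N)) ?_
  have h0 : ∀ᶠ x : Λ in cofinite, x ≠ 0 := by
    simp
  filter_upwards [h0] with x hx
  have hx0 : 0 < ‖(x : Space n)‖ := by simpa using hx
  have h := Real.pow_div_factorial_le_exp (c * ‖(x : Space n)‖ ^ 2) (by positivity) N
  rw [Real.norm_of_nonneg (Real.exp_pos _).le, Real.exp_neg]
  have h2 : (N.factorial / c ^ N) * (‖x‖⁻¹) ^ (2 * N)
      = ((c * ‖(x : Space n)‖ ^ 2) ^ N / N.factorial)⁻¹ := by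
    rw [mul_pow, ← pow_mul, inv_pow, inv_div, Submodule.norm_coe]
    field_simp
  rw [h2]
  exact inv_anti₀ (by positivity) h

/-- A summable majorant uniform for v in a ball, from ‖l‖² ≤ 2‖v+l‖² + 2R². It gives continuity of
the periodised Gaussian and the interchange of sum and integral. -/
theorem exp_neg_mul_norm_add_sq_le {c R : ℝ} (hc : 0 < c) {v : Space n} (hv : ‖v‖ ≤ R)
    (l : Space n) :
    Real.exp (-(c * ‖v + l‖ ^ 2)) ≤ Real.exp (c * R ^ 2) * Real.exp (-(c / 2 * ‖l‖ ^ 2)) := by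
  rw [← Real.exp_add, Real.exp_le_exp]
  have h1 : ‖l‖ ≤ ‖v + l‖ + ‖v‖ := by
    simpa using norm_sub_le (v + l) v
  have h2 : ‖l‖ ^ 2 ≤ 2 * ‖v + l‖ ^ 2 + 2 * R ^ 2 := by
    have h3 : ‖l‖ ≤ ‖v + l‖ + R := by linarith
    have : ‖l‖ ^ 2 ≤ (‖v + l‖ + R) ^ 2 := by gcongr
    nlinarith [sq_nonneg (‖v + l‖ - R)]
  nlinarith

theorem norm_cexp_neg_mul_norm_sq (a : ℂ) (v : Space n) :
    ‖cexp (-(π * a) * ‖v‖ ^ 2)‖ = Real.exp (-(π * a.re * ‖v‖ ^ 2)) := by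
  rw [Complex.norm_exp]
  congr 1
  have : (-(π * a) * (‖v‖ : ℂ) ^ 2) = ((-(π * ‖v‖ ^ 2) : ℝ) : ℂ) * a := by push_cast; ring
  rw [this, re_ofReal_mul]; ring

theorem summable_gaussian_translate (Λ : Submodule ℤ (Space n)) [DiscreteTopology Λ]
    [IsZLattice ℝ Λ] {a : ℂ} (ha : 0 < a.re) (v : Space n) :
    Summable fun l : Λ => cexp (-(π * a) * ‖v + l‖ ^ 2) := by
  have hc : 0 < π * a.re := by positivity
  refine Summable.of_norm_bounded ((summable_exp_neg_mul_norm_sq Λ (half_pos hc)).mul_left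
    (Real.exp (π * a.re * ‖v‖ ^ 2))) fun l => ?_
  rw [norm_cexp_neg_mul_norm_sq]
  exact exp_neg_mul_norm_add_sq_le hc le_rfl _

theorem continuous_tsum_gaussian (Λ : Submodule ℤ (Space n)) [DiscreteTopology Λ]
    [IsZLattice ℝ Λ] {a : ℂ} (ha : 0 < a.re) :
    Continuous fun v : Space n => ∑' l : Λ, cexp (-(π * a) * ‖v + l‖ ^ 2) := by
  have hc : 0 < π * a.re := by positivity
  rw [continuous_iff_continuousAt]
  intro v₀
  have hon : ContinuousOn (fun v : Space n => ∑' l : Λ, cexp (-(π * a) * ‖v + l‖ ^ 2))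
      (Metric.ball v₀ 1) := by
    refine continuousOn_tsum (u := fun l : Λ => Real.exp (π * a.re * (‖v₀‖ + 1) ^ 2) *
      Real.exp (-(π * a.re / 2 * ‖(l : Space n)‖ ^ 2))) (fun l => by fun_prop)
      ((summable_exp_neg_mul_norm_sq Λ (half_pos hc)).mul_left _) fun l v hv => ?_
    rw [norm_cexp_neg_mul_norm_sq]
    refine exp_neg_mul_norm_add_sq_le hc ?_ _
    have := norm_le_norm_add_norm_sub v₀ v
    rw [mem_ball_iff_norm'] at hv
    linarith
  exact hon.continuousAt (Metric.ball_mem_nhds _ one_pos)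

theorem tsum_gaussian_add_lattice (Λ : Submodule ℤ (Space n)) (a : ℂ) (v : Space n) {w : Space n}
    (hw : w ∈ Λ) :
    ∑' l : Λ, cexp (-(π * a) * ‖(v + w) + l‖ ^ 2) = ∑' l : Λ, cexp (-(π * a) * ‖v + l‖ ^ 2) := by
  rw [← (Equiv.addLeft (⟨w, hw⟩ : Λ)).tsum_eq
    (fun l : Λ => cexp (-(π * a) * ‖v + l‖ ^ 2))]
  simp [add_assoc]

/-- Self-duality: the Gram matrix is invertible over ℤ, so pairing with the basis is a bijection
from Λ onto ℤⁿ. It lets Λ itself index the Fourier modes. -/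
theorem IsUnimodular.exists_basis {Λ : Submodule ℤ (Space n)} (hΛ : IsUnimodular Λ) :
    ∃ b : Module.Basis (Fin n) ℤ Λ,
      |(Matrix.of fun i j : Fin n => inner ℝ (b i : Space n) (b j : Space n)).det| = 1 ∧
      ∃ φ : Λ ≃ (Fin n → ℤ), ∀ (w : Λ) (i : Fin n), (φ w i : ℝ) = inner ℝ (b i : Space n) w := by
  obtain ⟨b, hb⟩ := hΛ.det_gram
  refine ⟨b, hb, ?_⟩
  choose G hG using fun i j => hΛ.integral (b i) (b i).2 (b j) (b j).2
  have hdet : IsUnit (Matrix.of G).det := by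
    rw [Int.isUnit_iff_abs_eq]
    have : (Matrix.of fun i j : Fin n => inner ℝ (b i : Space n) (b j : Space n))
        = (Matrix.of G).map (Int.castRingHom ℝ) := by
      ext i j; simp [hG]
    rw [this, ← RingHom.mapMatrix_apply, ← RingHom.map_det] at hb
    simp only [eq_intCast] at hb
    exact_mod_cast hb
  refine ⟨b.equivFun.toEquiv.trans
    ⟨fun v => (Matrix.of G).mulVec v, fun v => (Matrix.of G)⁻¹.mulVec v, fun v => ?_, fun v => ?_⟩,
    fun w i => ?_⟩
  · simp [Matrix.mulVec_mulVec, Matrix.nonsing_inv_mul _ hdet]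
  · simp [Matrix.mulVec_mulVec, Matrix.mul_nonsing_inv _ hdet]
  · have hw : (w : Space n) = ∑ j, (b.repr w j : ℝ) • (b j : Space n) := by
      have h := congrArg Subtype.val (b.sum_repr w)
      rw [← h, AddSubmonoidClass.coe_finsetSum]
      exact Finset.sum_congr rfl fun j _ => by rw [Int.cast_smul_eq_zsmul]; rfl
    rw [hw, inner_sum]
    simp [inner_smul_right, hG, Matrix.mulVec, dotProduct, mul_comm]

/-- The Gram determinant is the square of the determinant of the coordinate matrix, so the lattice
has covolume 1. -/
theorem measurePreserving_sum_smul {b : Fin n → Space n}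
    (hb : |(Matrix.of fun i j : Fin n => inner ℝ (b i) (b j)).det| = 1) :
    MeasurePreserving (fun x : Fin n → ℝ => ∑ j, x j • b j) := by
  set M : Matrix (Fin n) (Fin n) ℝ := Matrix.of fun i j => b j i with hM
  have hG : (Matrix.of fun i j : Fin n => inner ℝ (b i) (b j)) = M.transpose * M := by
    ext i j
    simp [Matrix.mul_apply, hM, PiLp.inner_apply, mul_comm]
  have hdet : |M.det| = 1 := by
    rw [hG, Matrix.det_mul, Matrix.det_transpose, abs_mul] at hb
    nlinarith [abs_nonneg M.det]
  have hdet0 : M.det ≠ 0 := fun h => by simp [h] at hdet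
  have h1 : MeasurePreserving (Matrix.toLin' M) := by
    refine ⟨(Matrix.toLin' M).continuous_of_finiteDimensional.measurable, ?_⟩
    rw [Real.map_matrix_volume_pi_eq_smul_volume_pi hdet0, abs_inv, hdet]
    simp
  have h2 := (PiLp.volume_preserving_toLp (Fin n)).comp h1
  convert h2 using 1
  ext x i
  simp [Matrix.mulVec, dotProduct, hM, mul_comm]

theorem isQuotientMap_unitAddTorus_mk :
    IsQuotientMap (fun (x : Fin n → ℝ) (i : Fin n) => (x i : UnitAddCircle)) :=
  (IsOpenQuotientMap.piMap fun _ => QuotientAddGroup.isOpenQuotientMap_mk).isQuotientMap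

theorem mFourier_neg_coe (m : Fin n → ℤ) (x : Fin n → ℝ) :
    UnitAddTorus.mFourier (-m) (fun i => (x i : UnitAddCircle))
      = cexp (-2 * π * I * ((∑ i, m i * x i : ℝ) : ℂ)) := by
  simp only [UnitAddTorus.mFourier, ContinuousMap.coe_mk, fourier_coe_apply, Pi.neg_apply]
  rw [← Complex.exp_sum]
  congr 1
  push_cast
  rw [Finset.mul_sum]
  refine Finset.sum_congr rfl fun i _ => ?_
  simp; ring

theorem setOf_forall_Ioc_ae_eq :
    {x : Fin n → ℝ | ∀ i, x i ∈ Set.Ioc ((0 : Fin n → ℝ) i) ((0 : Fin n → ℝ) i + 1)} =ᵐ[volume]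
      {x : Fin n → ℝ | ∀ i, x i ∈ Set.Ico (0 : ℝ) 1} := by
  have h1 := Measure.univ_pi_Ioc_ae_eq_Icc (μ := fun _ : Fin n => (volume : Measure ℝ))
    (f := fun _ => 0) (g := fun _ => 1)
  have h2 := Measure.univ_pi_Ico_ae_eq_Icc (μ := fun _ : Fin n => (volume : Measure ℝ))
    (f := fun _ => 0) (g := fun _ => 1)
  have h3 := h1.trans h2.symm
  simpa [Set.pi, volume_pi] using h3

/-- Unfolding: the integral over a fundamental domain of a character times a periodised Gaussian. -/
theorem setIntegral_tsum_gaussian (Λ : Submodule ℤ (Space n)) [DiscreteTopology Λ]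
    [IsZLattice ℝ Λ] (b : Module.Basis (Fin n) ℤ Λ) {w : Space n}
    (hw : ∀ l ∈ Λ, ∃ k : ℤ, inner ℝ w l = (k : ℝ)) {a : ℂ} (ha : 0 < a.re) :
    ∫ v in ZSpan.fundamentalDomain (b.ofZLatticeBasis ℝ),
      cexp (-2 * π * I * (inner ℝ w v : ℝ)) * ∑' l : Λ, cexp (-(π * a) * ‖v + l‖ ^ 2)
      = (1 / a) ^ (n / 2 : ℂ) * cexp (-(π / a) * ‖w‖ ^ 2) := by
  set D := ZSpan.fundamentalDomain (b.ofZLatticeBasis ℝ) with hD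
  have hfd : IsAddFundamentalDomain Λ D := ZLattice.isAddFundamentalDomain b volume
  have hc : 0 < π * a.re := by positivity
  have hb0 : 0 < (π * a : ℂ).re := by rwa [re_ofReal_mul]
  set h : Space n → ℂ := fun v => cexp (-(π * a) * ‖v‖ ^ 2 + (-2 * π * I) * (inner ℝ w v : ℝ))
    with hh
  have hint : Integrable h := GaussianFourier.integrable_cexp_neg_mul_sq_norm_add hb0 _ w
  have hnorm : ∀ v, ‖h v‖ = Real.exp (-(π * a.re * ‖v‖ ^ 2)) := by
    intro v
    rw [hh]
    simp only
    rw [Complex.exp_add, norm_mul, norm_cexp_neg_mul_norm_sq]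
    have : (-2 * π * I * (inner ℝ w v : ℝ) : ℂ) = ((-2 * π * inner ℝ w v : ℝ) : ℂ) * I := by
      push_cast; ring
    rw [this, norm_exp_ofReal_mul_I, mul_one]
  obtain ⟨R, hR⟩ := (ZSpan.fundamentalDomain_isBounded (b.ofZLatticeBasis ℝ)).exists_norm_le
  have hDfin : volume D < ⊤ :=
    (ZSpan.fundamentalDomain_isBounded (b.ofZLatticeBasis ℝ)).measure_lt_top
  have : VAddInvariantMeasure Λ (Space n) volume :=
    inferInstanceAs (VAddInvariantMeasure Λ.toAddSubgroup (Space n) volume)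
  have hbound : ∀ l : Λ, ∀ v ∈ D, ‖h (v + l)‖ ≤ Real.exp (π * a.re * R ^ 2) *
      Real.exp (-(π * a.re / 2 * ‖(l : Space n)‖ ^ 2)) := by
    intro l v hv
    rw [hnorm]
    exact exp_neg_mul_norm_add_sq_le hc (hR v hv) _
  have hsum : Summable fun l : Λ => ∫ v in D, ‖h (v + l)‖ := by
    refine Summable.of_nonneg_of_le (fun l => by positivity) (fun l => ?_)
      (((summable_exp_neg_mul_norm_sq Λ (half_pos hc)).mul_left
        (Real.exp (π * a.re * R ^ 2))).mul_right (volume.real D))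
    refine (Real.le_norm_self _).trans ?_
    refine norm_setIntegral_le_of_norm_le_const hDfin fun v hv => ?_
    rw [norm_norm]
    exact hbound l v hv
  have hswap := hasSum_integral_of_summable_integral_norm (μ := volume.restrict D)
    (F := fun (l : Λ) v => h (v + l))
    (fun l => ((hint.comp_add_right (l : Space n)).integrableOn)) hsum
  have hunf := hfd.integral_eq_tsum'' h hint
  have hunf' : ∫ v, h v = ∫ v in D, ∑' l : Λ, h (v + l) := by
    rw [hunf, ← hswap.tsum_eq]
    refine tsum_congr fun l => ?_
    refine integral_congr_ae (Eventually.of_forall fun v => ?_)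
    change h (l + v) = h (v + l)
    rw [add_comm]
  have hpt : ∀ v, cexp (-2 * π * I * (inner ℝ w v : ℝ)) * ∑' l : Λ, cexp (-(π * a) * ‖v + l‖ ^ 2)
      = ∑' l : Λ, h (v + l) := by
    intro v
    rw [← tsum_mul_left]
    refine tsum_congr fun l => ?_
    -- The character of w is trivial on Λ because the inner product with l is an integer.
    obtain ⟨k, hk⟩ := hw l l.2
    simp only [hh]
    rw [Complex.exp_add, mul_comm, inner_add_right, hk]
    congr 1
    rw [show (-2 * π * I * ((inner ℝ w v + k : ℝ) : ℂ) : ℂ)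
      = -2 * π * I * (inner ℝ w v : ℝ) + (-k : ℤ) * (2 * π * I) by push_cast; ring,
      Complex.exp_add, Complex.exp_int_mul_two_pi_mul_I, mul_one]
  simp only [hpt]
  rw [← hunf']
  rw [hh, GaussianFourier.integral_cexp_neg_mul_sq_norm_add hb0]
  have ha0 : a ≠ 0 := fun h0 => by simp [h0] at ha
  have hpi : (π : ℂ) ≠ 0 := by exact_mod_cast Real.pi_ne_zero
  congr 1
  · rw [finrank_euclideanSpace_fin]
    congr 1
    field_simp
  · congr 1
    have : (-2 * π * I : ℂ) ^ 2 = -(4 * π ^ 2) := by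
      rw [mul_pow, I_sq]; ring
    rw [this]
    field_simp

/-- In basis coordinates the periodised Gaussian is a continuous function on the torus. By
unfolding, its Fourier coefficient at the mode of w is the Fourier transform of the Gaussian at w.
These coefficients are summable, so the Fourier series may be evaluated at 0. -/
theorem IsUnimodular.tsum_gaussian {Λ : Submodule ℤ (Space n)} [DiscreteTopology Λ]
    [IsZLattice ℝ Λ] (hΛ : IsUnimodular Λ) {a : ℂ} (ha : 0 < a.re) :
    ∑' x : Λ, cexp (-(π * a) * ‖(x : Space n)‖ ^ 2)
      = (1 / a) ^ (n / 2 : ℂ) * ∑' x : Λ, cexp (-(π / a) * ‖(x : Space n)‖ ^ 2) := by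
  obtain ⟨b, hdet, φ, hφ⟩ := hΛ.exists_basis
  set B := b.ofZLatticeBasis ℝ Λ with hB
  let e : (Fin n → ℝ) ≃L[ℝ] Space n := B.equivFun.symm.toContinuousLinearEquiv
  have he : ∀ x, e x = ∑ j, x j • (b j : Space n) := by
    intro x
    simp only [e]
    simp [hB]
  have hmp : MeasurePreserving e := by
    have := measurePreserving_sum_smul hdet
    rwa [← funext he] at this
  set Fe : Space n → ℂ := fun v => ∑' l : Λ, cexp (-(π * a) * ‖v + l‖ ^ 2) with hFe
  have hFec : Continuous Fe := continuous_tsum_gaussian Λ ha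
  let g : C(Fin n → ℝ, ℂ) := ⟨fun x => Fe (e x), hFec.comp e.continuous⟩
  have hg : Function.FactorsThrough g
      (fun (x : Fin n → ℝ) (i : Fin n) => (x i : UnitAddCircle)) := by
    intro x y hxy
    have : ∀ i, ∃ k : ℤ, x i = y i + k := by
      intro i
      have h := congrFun hxy i
      simp only at h
      rw [QuotientAddGroup.eq, AddSubgroup.mem_zmultiples_iff] at h
      obtain ⟨k, hk⟩ := h
      refine ⟨-k, ?_⟩
      simp at hk
      push_cast
      linarith
    choose k hk using this
    have h1 : e x = e y + ∑ j, k j • (b j : Space n) := by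
      rw [he, he, ← Finset.sum_add_distrib]
      refine Finset.sum_congr rfl fun i _ => ?_
      rw [hk, add_smul, Int.cast_smul_eq_zsmul]
    change Fe (e x) = Fe (e y)
    rw [h1]
    exact tsum_gaussian_add_lattice Λ a _
      (Submodule.sum_mem _ fun j _ => Submodule.smul_mem _ _ (b j).2)
  have hq : IsQuotientMap (⟨fun x i => (x i : UnitAddCircle),
    isQuotientMap_unitAddTorus_mk.continuous⟩ : C(Fin n → ℝ, UnitAddTorus (Fin n))) :=
    isQuotientMap_unitAddTorus_mk
  let f : C(UnitAddTorus (Fin n), ℂ) := hq.lift g hg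
  have hf : ∀ x : Fin n → ℝ, f (fun i => (x i : UnitAddCircle)) = Fe (e x) := by
    intro x
    exact congrArg (fun k : C(Fin n → ℝ, ℂ) => k x)
      (hq.lift_comp g hg)
  have hcoeff : ∀ w : Λ, UnitAddTorus.mFourierCoeff f (φ w)
      = (1 / a) ^ (n / 2 : ℂ) * cexp (-(π / a) * ‖(w : Space n)‖ ^ 2) := by
    intro w
    rw [UnitAddTorus.mFourierCoeff_eq_integral f (φ w) 0,
      setIntegral_congr_set setOf_forall_Ioc_ae_eq,
      ← setIntegral_tsum_gaussian Λ b (w := w) (fun l hl => hΛ.integral _ w.2 _ hl) ha,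
      ← hmp.setIntegral_preimage_emb e.toHomeomorph.measurableEmbedding]
    have hset : {x : Fin n → ℝ | ∀ i, x i ∈ Set.Ico (0 : ℝ) 1}
        = e ⁻¹' ZSpan.fundamentalDomain B := by
      ext x
      simp only [Set.mem_ofPred_eq, Set.mem_preimage, ZSpan.mem_fundamentalDomain]
      have : ∀ i, B.repr (e x) i = x i := by
        intro i
        exact congrFun (B.equivFun.apply_symm_apply x) i
      simp only [this]
    rw [hset]
    refine integral_congr_ae (Eventually.of_forall fun x => ?_)
    simp only [smul_eq_mul, hf]
    rw [mFourier_neg_coe]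
    have hin : ∑ i, (φ w i : ℝ) * x i = inner ℝ (w : Space n) (e x) := by
      rw [he, inner_sum]
      refine Finset.sum_congr rfl fun i _ => ?_
      rw [hφ, inner_smul_right, mul_comm, real_inner_comm]
    rw [hin]
  have ha' : 0 < (1 / a).re := by
    rw [one_div, inv_re]
    exact div_pos ha (normSq_pos.2 fun h0 => by simp [h0] at ha)
  have hsum0 : Summable fun w : Λ => (1 / a) ^ (n / 2 : ℂ) *
      cexp (-(π / a) * ‖(w : Space n)‖ ^ 2) := by
    have := (summable_gaussian_translate Λ ha' 0).mul_left ((1 / a) ^ (n / 2 : ℂ))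
    simpa [div_eq_mul_inv] using this
  have hsum : Summable (UnitAddTorus.mFourierCoeff f) := by
    rw [← φ.summable_iff]
    exact hsum0.congr fun w => (hcoeff w).symm
  have hfin := (UnitAddTorus.hasSum_mFourier_series_apply_of_summable hsum
    (fun i => ((0 : Fin n → ℝ) i : UnitAddCircle))).tsum_eq
  rw [hf, ← φ.tsum_eq] at hfin
  simp only [hcoeff] at hfin
  have h0 : Fe (e 0) = ∑' x : Λ, cexp (-(π * a) * ‖(x : Space n)‖ ^ 2) := by
    simp [hFe]
  rw [← h0, ← hfin, ← tsum_mul_left]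
  refine tsum_congr fun w => ?_
  have h1 : UnitAddTorus.mFourier (φ w) (fun i => ((0 : Fin n → ℝ) i : UnitAddCircle)) = 1 := by
    have := mFourier_neg_coe (-φ w) (0 : Fin n → ℝ)
    rw [neg_neg] at this
    rw [this]
    simp
  rw [h1, smul_eq_mul, mul_one]

/-! ### Theta series of lattices: transformation, growth, leading terms -/

theorem re_neg_I_mul (z : ℂ) : (-I * z).re = z.im := by simp

theorem neg_I_mul_cpow_half_pow_eight (z : ℂ) : ((-I * z) ^ (1 / 2 : ℂ)) ^ 8 = z ^ 4 := by
  rw [← Complex.cpow_nat_mul]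
  have : ((8 : ℕ) : ℂ) * (1 / 2) = (4 : ℕ) := by norm_num
  rw [this, Complex.cpow_natCast, mul_pow]
  have : (-I) ^ 4 = 1 := by rw [Even.neg_pow (by decide), I_pow_four]
  rw [this, one_mul]

theorem norm_neg_I_mul_cpow_half {y : ℝ} (hy : 0 < y) :
    ‖(-I * (y * I)) ^ (1 / 2 : ℂ)‖ = √y := by
  have : -I * (y * I) = (y : ℂ) := by linear_combination (-y : ℂ) * I_mul_I
  rw [this, Complex.norm_cpow_eq_rpow_re_of_pos hy, Real.sqrt_eq_rpow]
  norm_num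

theorem norm_theta_term (x : Space n) (z : ℂ) :
    ‖cexp (π * I * ((‖x‖ ^ 2 : ℝ) : ℂ) * z)‖ = Real.exp (-(π * z.im * ‖x‖ ^ 2)) := by
  rw [Complex.norm_exp]
  congr 1
  have : (π * I * ((‖x‖ ^ 2 : ℝ) : ℂ) * z) = ((π * ‖x‖ ^ 2 : ℝ) : ℂ) * (I * z) := by
    push_cast; ring
  rw [this, re_ofReal_mul, I_mul_re]
  ring

/-- If the terms of a series decay exponentially in the upper half plane, so does the difference
between its sum and the sum of the terms of slowest decay. -/
theorem isBigO_tsum_sub_sum {ι : Type*} {f : ι → ℂ → ℂ} {e : ι → ℝ} {s : Finset ι} {r : ℕ}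
    (hf : ∀ i z, 0 < z.im → ‖f i z‖ = Real.exp (-(π * z.im * e i)))
    (he : ∀ i, i ∉ s → (r : ℝ) ≤ e i)
    (hs : ∀ c : ℝ, 0 < c → Summable fun i => Real.exp (-(c * e i))) :
    (fun z => ∑' i, f i z - ∑ i ∈ s, f i z) =O[comap Complex.im atTop]
      fun z => Real.exp (-π * z.im) ^ r := by
  refine IsBigO.of_bound (∑' i, Real.exp (π * r) * Real.exp (-(π * e i))) ?_
  filter_upwards [eventually_im_ge 1] with z hz
  have hz0 : 0 < z.im := by linarith
  have hsum : Summable fun i => ‖f i z‖ := by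
    simp only [hf _ z hz0]
    exact hs _ (by positivity)
  have hsplit : ∑' i, f i z - ∑ i ∈ s, f i z = ∑' i : (((s : Set ι)ᶜ : Set ι)), f i z := by
    rw [sub_eq_iff_eq_add', hsum.of_norm.sum_add_tsum_compl]
  have hs2 := ((hs π Real.pi_pos).mul_left (Real.exp (π * r))).mul_right
    (Real.exp (-π * z.im) ^ r)
  rw [hsplit, Real.norm_of_nonneg (by positivity), ← tsum_mul_right]
  refine (norm_tsum_le_tsum_norm (hsum.subtype _)).trans ?_
  refine (Summable.tsum_le_tsum (fun x => ?_) (hsum.subtype _) (hs2.subtype _)).trans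
    (Summable.tsum_subtype_le _ _ (fun x => by positivity) hs2)
  simp only [Function.comp_apply]
  rw [hf _ z hz0, ← Real.exp_add, ← Real.exp_nat_mul, ← Real.exp_add, Real.exp_le_exp]
  have h1 := he x x.2
  -- Expanded, this is the required comparison of exponents; the constant in the bound comes from
  -- the series at height Im z = 1.
  have h2 : 0 ≤ π * ((z.im - 1) * (e x - r)) := by
    apply mul_nonneg Real.pi_pos.le
    apply mul_nonneg <;> linarith
  nlinarith

theorem IsUnimodular.exists_norm_sq_eq {Λ : Submodule ℤ (Space n)} (hΛ : IsUnimodular Λ)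
    (x : Λ) : ∃ k : ℕ, ‖(x : Space n)‖ ^ 2 = k := by
  obtain ⟨k, hk⟩ := hΛ.integral x x.2 x x.2
  rw [real_inner_self_eq_norm_sq] at hk
  have : 0 ≤ k := by
    have : (0 : ℝ) ≤ k := hk ▸ sq_nonneg _
    exact_mod_cast this
  lift k to ℕ using this
  exact ⟨k, by simpa using hk⟩

theorem IsUnimodular.theta_add_two {Λ : Submodule ℤ (Space n)} (hΛ : IsUnimodular Λ) (z : ℂ) :
    theta Λ (z + 2) = theta Λ z := by
  refine tsum_congr fun x => ?_
  obtain ⟨k, hk⟩ := hΛ.exists_norm_sq_eq x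
  rw [hk, mul_add, Complex.exp_add]
  have : (π * I * ((k : ℝ) : ℂ) * 2) = (k : ℤ) * (2 * π * I) := by push_cast; ring
  rw [this, Complex.exp_int_mul_two_pi_mul_I, mul_one]

theorem theta_mul_I' (Λ : Submodule ℤ (Space n)) (y : ℝ) : theta Λ (y * I) =
      ((∑' x : Λ, Real.exp (-(π * y * ‖(x : Space n)‖ ^ 2)) : ℝ) : ℂ) := by
  rw [theta_mul_I]
  congr 1
  exact tsum_congr fun x => by congr 1; ring

theorem norm_theta_mul_I (Λ : Submodule ℤ (Space n)) (y : ℝ) :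
    ‖theta Λ (y * I)‖ = ∑' x : Λ, Real.exp (-(π * y * ‖(x : Space n)‖ ^ 2)) := by
  rw [theta_mul_I', norm_real, Real.norm_of_nonneg (tsum_nonneg fun x => (Real.exp_pos _).le)]

section

variable (Λ : Submodule ℤ (Space n)) [DiscreteTopology Λ] [IsZLattice ℝ Λ]

theorem summable_norm_theta_term {z : ℂ} (hz : 0 < z.im) :
    Summable fun x : Λ => ‖cexp (π * I * ((‖(x : Space n)‖ ^ 2 : ℝ) : ℂ) * z)‖ := by
  simp only [norm_theta_term]
  exact summable_exp_neg_mul_norm_sq Λ (by positivity)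

theorem differentiableOn_theta : DifferentiableOn ℂ (theta Λ) {z | 0 < z.im} := by
  intro z (hz : 0 < z.im)
  -- On this half plane the terms have a common summable majorant.
  have hU : IsOpen {w : ℂ | z.im / 2 < w.im} := isOpen_lt continuous_const Complex.continuous_im
  have h := differentiableOn_tsum_of_summable_norm
    (F := fun (x : Λ) (w : ℂ) => cexp (π * I * ((‖(x : Space n)‖ ^ 2 : ℝ) : ℂ) * w))
    (summable_exp_neg_mul_norm_sq Λ (c := π * (z.im / 2)) (by positivity))
    (fun x => by fun_prop) hU (fun x w hw => by
      rw [norm_theta_term]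
      gcongr
      exact le_of_lt hw)
  exact ((h z (by simp only [Set.mem_ofPred_eq]; linarith)).differentiableAt
    (hU.mem_nhds (by simp only [Set.mem_ofPred_eq]; linarith))).differentiableWithinAt

theorem norm_theta_le {z : ℂ} (hz : 0 < z.im) :
    ‖theta Λ z‖ ≤ ∑' x : Λ, Real.exp (-(π * z.im * ‖(x : Space n)‖ ^ 2)) := by
  refine (norm_tsum_le_tsum_norm (summable_norm_theta_term Λ hz)).trans (le_of_eq ?_)
  simp only [norm_theta_term]

variable {Λ}

theorem IsUnimodular.theta_neg_one_div (hΛ : IsUnimodular Λ) {z : ℂ} (hz : 0 < z.im) :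
    theta Λ (-1 / z) = ((-I * z) ^ (1 / 2 : ℂ)) ^ n * theta Λ z := by
  have hz0 := ne_zero_of_im_pos hz
  have hre : 0 < (-I * z).re := by rwa [re_neg_I_mul]
  have ha0 : -I * z ≠ 0 := mul_ne_zero (neg_ne_zero.2 I_ne_zero) hz0
  have h := hΛ.tsum_gaussian hre
  have h1 : ∑' x : Λ, cexp (-(π * (-I * z)) * ‖(x : Space n)‖ ^ 2) = theta Λ z := by
    refine tsum_congr fun x => ?_
    congr 1; push_cast; ring
  have h2 : ∑' x : Λ, cexp (-(π / (-I * z)) * ‖(x : Space n)‖ ^ 2) = theta Λ (-1 / z) := by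
    refine tsum_congr fun x => ?_
    congr 1; push_cast
    have hI := I_ne_zero
    field_simp
    linear_combination ((‖(x : Space n)‖ : ℂ) ^ 2) * I_sq
  rw [h1, h2] at h
  have harg : (-I * z).arg ≠ π := by
    intro h
    have := (Complex.arg_eq_pi_iff.1 h).1
    linarith
  rw [h, one_div (-I * z), inv_cpow _ _ harg, ← mul_assoc, ← Complex.cpow_nat_mul]
  have : (n : ℂ) * (1 / 2) = n / 2 := by ring
  rw [this, mul_inv_cancel₀, one_mul]
  rw [Ne, cpow_eq_zero_iff, not_and_or]
  exact Or.inl ha0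

/-- Moderate growth of theta series at the real line. -/
theorem IsUnimodular.norm_theta_le_of_im_le_one (hΛ : IsUnimodular Λ) {z : ℂ} (hz : 0 < z.im)
    (hz1 : z.im ≤ 1) : ‖theta Λ z‖ ≤ ‖theta Λ I‖ * (√z.im)⁻¹ ^ n := by
  have hinv : 0 < z.im⁻¹ := inv_pos.2 hz
  have h1 : ‖theta Λ z‖ ≤ ‖theta Λ ((z.im : ℂ) * I)‖ := by
    rw [norm_theta_mul_I Λ]; exact norm_theta_le Λ hz
  have h2 := hΛ.theta_neg_one_div (z := ((z.im⁻¹ : ℝ) : ℂ) * I) (by simpa using hz)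
  have h3 : -1 / (((z.im⁻¹ : ℝ) : ℂ) * I) = (z.im : ℂ) * I := by
    have : (z.im : ℂ) ≠ 0 := by exact_mod_cast hz.ne'
    have hI := I_ne_zero
    push_cast
    field_simp
    rw [I_sq]
  have h4 : ‖theta Λ (((z.im⁻¹ : ℝ) : ℂ) * I)‖ ≤ ‖theta Λ I‖ := by
    have hI := norm_theta_mul_I Λ 1
    rw [ofReal_one, one_mul] at hI
    rw [norm_theta_mul_I Λ, hI]
    refine Summable.tsum_le_tsum (fun x => ?_) (summable_exp_neg_mul_norm_sq Λ (by positivity))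
      (summable_exp_neg_mul_norm_sq Λ (by positivity))
    gcongr
    exact (one_le_inv₀ hz).2 hz1
  rw [h3] at h2
  rw [h2, norm_mul, norm_pow, norm_neg_I_mul_cpow_half hinv, Real.sqrt_inv] at h1
  rw [mul_comm]
  exact h1.trans (by gcongr)

variable (Λ) in
theorem finite_norm_sq_eq (r : ℝ) : {x : Λ | ‖(x : Space n)‖ ^ 2 = r}.Finite := by
  have hs := summable_exp_neg_mul_norm_sq Λ (c := 1) one_pos
  have := (hs.tendsto_cofinite_zero.eventually_lt_const (Real.exp_pos (-r)))
  rw [eventually_cofinite] at this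
  refine this.subset fun x (hx : _ = r) => ?_
  simp only [Set.mem_ofPred_eq, not_lt, one_mul, hx, le_refl]

/-- The beginning of the `q`-expansion of a theta series. -/
theorem IsUnimodular.theta_sub_isBigO (hΛ : IsUnimodular Λ) {m : ℕ} (hm : 1 ≤ m)
    (hmin : IsShortestLength Λ m) :
    (fun z => theta Λ z - (1 + numVectors Λ m * cexp (π * I * z) ^ m))
      =O[comap Complex.im atTop] fun z => Real.exp (-π * z.im) ^ (m + 1) := by
  classical
  set t : Finset Λ := (finite_norm_sq_eq Λ m).toFinset with ht
  have hmem : ∀ x : Λ, x ∈ t ↔ ‖(x : Space n)‖ ^ 2 = m := by simp [ht]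
  have h0t : (0 : Λ) ∉ t := by
    rw [hmem]
    have : (m : ℝ) ≠ 0 := by exact_mod_cast (by omega : m ≠ 0)
    simpa using this.symm
  have hcard : numVectors Λ m = t.card := by
    rw [numVectors, ← Set.ncard_coe_finset, ← Set.ncard_image_of_injective _ Subtype.val_injective]
    congr 1
    ext x
    simp [hmem, and_comm]
  -- Lengths are integers, so the next one after m is at least m + 1.
  have hfar : ∀ x : Λ, x ∉ insert 0 t → (m + 1 : ℝ) ≤ ‖(x : Space n)‖ ^ 2 := by
    intro x hx
    rw [Finset.mem_insert, not_or, hmem] at hx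
    obtain ⟨k, hk⟩ := hΛ.exists_norm_sq_eq x
    have h1 : (m : ℝ) ≤ ‖(x : Space n)‖ ^ 2 :=
      hmin.2 ⟨x, x.2, by simpa using hx.1, rfl⟩
    rw [hk] at h1 hx ⊢
    have h2 : m ≤ k := by exact_mod_cast h1
    have h3 : k ≠ m := by exact_mod_cast hx.2
    exact_mod_cast (by omega : m + 1 ≤ k)
  have hfin : ∀ z, ∑ x ∈ insert 0 t, cexp (π * I * ((‖(x : Space n)‖ ^ 2 : ℝ) : ℂ) * z)
      = 1 + numVectors Λ m * cexp (π * I * z) ^ m := by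
    intro z
    rw [Finset.sum_insert h0t, hcard]
    congr 1
    · simp
    · rw [Finset.sum_congr rfl (g := fun _ => cexp (π * I * z) ^ m), Finset.sum_const,
        nsmul_eq_mul]
      intro x hx
      rw [(hmem x).1 hx, ← Complex.exp_nat_mul]
      congr 1; push_cast; ring
  have h := isBigO_tsum_sub_sum (s := insert 0 t) (r := m + 1)
    (fun (x : Λ) z _ => norm_theta_term (x : Space n) z) (by exact_mod_cast hfar)
    (fun c hc => summable_exp_neg_mul_norm_sq Λ hc)
  simp only [hfin] at h
  exact h

end

/-! ### Theta forms -/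

/-- Holomorphic functions on the upper half plane that transform under the theta group like the
`n`-th power of Jacobi's theta function and have moderate growth at the real line. -/
structure IsThetaForm (n : ℕ) (f : ℂ → ℂ) : Prop where
  diff : DifferentiableOn ℂ f {z | 0 < z.im}
  add_two : ∀ z : ℂ, 0 < z.im → f (z + 2) = f z
  neg_one_div : ∀ z : ℂ, 0 < z.im → f (-1 / z) = ((-I * z) ^ (1 / 2 : ℂ)) ^ n * f z
  growth : ∃ C : ℝ, 0 ≤ C ∧ ∀ z : ℂ, 0 < z.im → z.im ≤ 1 → ‖f z‖ ≤ C * (√z.im)⁻¹ ^ n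

namespace IsThetaForm

variable {m : ℕ} {f g : ℂ → ℂ}

theorem mul (hf : IsThetaForm n f) (hg : IsThetaForm m g) :
    IsThetaForm (n + m) fun z => f z * g z where
  diff := hf.diff.mul hg.diff
  add_two z hz := by simp only [hf.add_two z hz, hg.add_two z hz]
  neg_one_div z hz := by simp only [hf.neg_one_div z hz, hg.neg_one_div z hz]; ring
  growth := by
    obtain ⟨C, hC0, hC⟩ := hf.growth
    obtain ⟨K, hK0, hK⟩ := hg.growth
    refine ⟨C * K, by positivity, fun z hz hz1 => ?_⟩
    rw [norm_mul, pow_add, mul_mul_mul_comm]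
    exact mul_le_mul (hC z hz hz1) (hK z hz hz1) (norm_nonneg _) (by positivity)

theorem const (c : ℂ) : IsThetaForm 0 fun _ => c where
  diff := differentiableOn_const _
  add_two _ _ := rfl
  neg_one_div z _ := by simp
  growth := ⟨‖c‖, norm_nonneg _, fun z _ _ => by simp⟩

theorem const_mul (hf : IsThetaForm n f) (c : ℂ) : IsThetaForm n fun z => c * f z := by
  simpa using (const c).mul hf

theorem pow (hf : IsThetaForm n f) (k : ℕ) : IsThetaForm (n * k) fun z => f z ^ k := by
  induction k with
  | zero => simpa using const 1
  | succ k ih => simpa only [pow_succ, Nat.mul_succ] using ih.mul hf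

theorem add (hf : IsThetaForm n f) (hg : IsThetaForm n g) : IsThetaForm n fun z => f z + g z where
  diff := hf.diff.add hg.diff
  add_two z hz := by simp only [hf.add_two z hz, hg.add_two z hz]
  neg_one_div z hz := by simp only [hf.neg_one_div z hz, hg.neg_one_div z hz]; ring
  growth := by
    obtain ⟨C, hC0, hC⟩ := hf.growth
    obtain ⟨K, hK0, hK⟩ := hg.growth
    refine ⟨C + K, by positivity, fun z hz hz1 => ?_⟩
    rw [add_mul]
    exact (norm_add_le _ _).trans (add_le_add (hC z hz hz1) (hK z hz hz1))

theorem sub (hf : IsThetaForm n f) (hg : IsThetaForm n g) :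
    IsThetaForm n fun z => f z - g z := by
  simpa [sub_eq_add_neg] using hf.add (hg.const_mul (-1))

/-- A theta form that vanishes at `i∞` to sufficiently large order is zero. -/
theorem eq_zero (hf : IsThetaForm n f) {k : ℕ} (hk : n < 8 * k)
    (hinf : f =O[comap Complex.im atTop] fun z => Real.exp (-π * z.im) ^ k)
    {z : ℂ} (hz : 0 < z.im) : f z = 0 := by
  obtain ⟨C, hC0, hC⟩ := hf.growth
  -- The eighth power turns the square-root factor into z^(4n), so w = n, and it raises the order of
  -- vanishing to 8k.
  have h := thetaGroup_eq_zero (C := C ^ 8) (F := fun z => f z ^ 8) hk (hf.diff.pow 8)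
    (fun z hz => by simp only [hf.add_two z hz])
    (fun z hz => by
      simp only [hf.neg_one_div z hz]
      rw [mul_pow, ← pow_mul, mul_comm n 8, pow_mul, neg_I_mul_cpow_half_pow_eight, ← pow_mul])
    (fun z hz hz1 => by
      rw [norm_pow]
      have h1 := pow_le_pow_left₀ (norm_nonneg _) (hC z hz hz1) 8
      have h2 : (√z.im)⁻¹ ^ 8 = z.im⁻¹ ^ 4 := by
        rw [inv_pow, inv_pow, show (8 : ℕ) = 2 * 4 from rfl, pow_mul, Real.sq_sqrt hz.le]
      rwa [mul_pow, ← pow_mul, mul_comm n 8, pow_mul, h2, ← pow_mul] at h1)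
    (by simpa only [← pow_mul, mul_comm 8 k] using hinf.pow 8) hz
  exact pow_eq_zero_iff (by norm_num) |>.1 h

end IsThetaForm

theorem IsUnimodular.isThetaForm {Λ : Submodule ℤ (Space n)} [DiscreteTopology Λ]
    [IsZLattice ℝ Λ] (hΛ : IsUnimodular Λ) : IsThetaForm n (theta Λ) where
  diff := differentiableOn_theta Λ
  add_two z _ := hΛ.theta_add_two z
  neg_one_div _ hz := hΛ.theta_neg_one_div hz
  growth := ⟨‖theta Λ I‖, norm_nonneg _, fun _ hz hz1 => hΛ.norm_theta_le_of_im_le_one hz hz1⟩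

/-! ### Jacobi's theta constants -/

/-- Jacobi's theta constant `θ₂`. -/
noncomputable def thetaTwo (z : ℂ) : ℂ := cexp (π * I * z / 4) * jacobiTheta₂ (z / 2) z

/-- Jacobi's theta constant `θ₃`. -/
noncomputable def thetaThree (z : ℂ) : ℂ := jacobiTheta₂ 0 z

/-- Jacobi's theta constant `θ₄`. -/
noncomputable def thetaFour (z : ℂ) : ℂ := jacobiTheta₂ (1 / 2) z

theorem cpow_half_ne_zero {z : ℂ} (hz : 0 < z.im) : (-I * z) ^ (1 / 2 : ℂ) ≠ 0 := by
  rw [Ne, cpow_eq_zero_iff, not_and_or]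
  exact Or.inl (mul_ne_zero (neg_ne_zero.2 I_ne_zero) (ne_zero_of_im_pos hz))

theorem thetaThree_neg_one_div {z : ℂ} (hz : 0 < z.im) :
    thetaThree (-1 / z) = (-I * z) ^ (1 / 2 : ℂ) * thetaThree z := by
  have h := jacobiTheta₂_functional_equation 0 z
  have hj := cpow_half_ne_zero hz
  simp only [zero_div, ne_eq, OfNat.ofNat_ne_zero, not_false_eq_true, zero_pow, mul_zero,
    Complex.exp_zero, mul_one] at h
  rw [thetaThree, thetaThree, h, ← mul_assoc, mul_one_div_cancel hj, one_mul]

theorem thetaTwo_neg_one_div {z : ℂ} (hz : 0 < z.im) :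
    thetaTwo (-1 / z) = (-I * z) ^ (1 / 2 : ℂ) * thetaFour z := by
  have h := jacobiTheta₂_functional_equation (1 / 2) z
  have hj := cpow_half_ne_zero hz
  have hz0 := ne_zero_of_im_pos hz
  have h1 : (-1 / z) / 2 = -((1 / 2) / z) := by ring
  have h2 : π * I * (-1 / z) / 4 = -π * I * (1 / 2) ^ 2 / z := by ring
  rw [thetaTwo, thetaFour, h, h1, jacobiTheta₂_neg_left, h2, ← mul_assoc, ← mul_assoc,
    mul_one_div_cancel hj, one_mul]

theorem thetaFour_neg_one_div {z : ℂ} (hz : 0 < z.im) :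
    thetaFour (-1 / z) = (-I * z) ^ (1 / 2 : ℂ) * thetaTwo z := by
  have h := jacobiTheta₂_functional_equation (z / 2) z
  have hj := cpow_half_ne_zero hz
  have hz0 := ne_zero_of_im_pos hz
  have h1 : z / 2 / z = 1 / 2 := by field_simp
  have h2 : -π * I * (z / 2) ^ 2 / z = -(π * I * z / 4) := by field_simp; norm_num
  rw [thetaTwo, thetaFour, h, h1, h2, Complex.exp_neg]
  field_simp

theorem thetaThree_add_two (z : ℂ) : thetaThree (z + 2) = thetaThree z :=
  jacobiTheta₂_add_right _ _

theorem thetaFour_add_two (z : ℂ) : thetaFour (z + 2) = thetaFour z :=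
  jacobiTheta₂_add_right _ _

theorem thetaTwo_add_two (z : ℂ) : thetaTwo (z + 2) = I * thetaTwo z := by
  have h1 : (z + 2) / 2 = z / 2 + 1 := by ring
  have h2 : π * I * (z + 2) / 4 = π * I * z / 4 + π / 2 * I := by ring
  rw [thetaTwo, thetaTwo, h1, jacobiTheta₂_add_left, jacobiTheta₂_add_right, h2, Complex.exp_add,
    Complex.exp_pi_div_two_mul_I]
  ring

theorem differentiableOn_thetaThree : DifferentiableOn ℂ thetaThree {z | 0 < z.im} :=
  fun _ hz => (differentiableAt_jacobiTheta₂_snd 0 hz).differentiableWithinAt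

theorem differentiableOn_thetaFour : DifferentiableOn ℂ thetaFour {z | 0 < z.im} :=
  fun _ hz => (differentiableAt_jacobiTheta₂_snd (1 / 2) hz).differentiableWithinAt

theorem differentiableOn_thetaTwo : DifferentiableOn ℂ thetaTwo {z | 0 < z.im} := by
  intro z hz
  have h1 : DifferentiableAt ℂ (fun w : ℂ => jacobiTheta₂ (w / 2) w) z :=
    (hasFDerivAt_jacobiTheta₂ (z / 2) hz).differentiableAt.comp z
      (f := fun w : ℂ => (w / 2, w)) (by fun_prop)
  have h2 : DifferentiableAt ℂ (fun w : ℂ => cexp (π * I * w / 4)) z := by fun_prop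
  exact (h2.mul h1).differentiableWithinAt

theorem norm_thetaTwo_term (k : ℤ) (z : ℂ) :
    ‖cexp (π * I * z / 4) * jacobiTheta₂_term k (z / 2) z‖
      = Real.exp (-(π * z.im * (k + 1 / 2) ^ 2)) := by
  rw [norm_mul, norm_jacobiTheta₂_term, Complex.norm_exp, ← Real.exp_add]
  congr 1
  have h1 : π * I * z / 4 = ((π / 4 : ℝ) : ℂ) * (I * z) := by push_cast; ring
  have h2 : (z / 2).im = z.im / 2 := by
    rw [show z / 2 = z / ((2 : ℝ) : ℂ) by norm_num, Complex.div_ofReal_im]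
  rw [h1, h2, re_ofReal_mul, I_mul_re]
  ring

theorem norm_jacobiTheta₂_term_ofReal (k : ℤ) (t : ℝ) (z : ℂ) :
    ‖jacobiTheta₂_term k t z‖ = Real.exp (-(π * z.im * k ^ 2)) := by
  rw [norm_jacobiTheta₂_term, ofReal_im]
  congr 1; ring

theorem summable_exp_neg_mul_sq {c : ℝ} (hc : 0 < c) :
    Summable fun k : ℤ => Real.exp (-(c * (k : ℝ) ^ 2)) := by
  have him : (((c / π : ℝ) : ℂ) * I).im = c / π := by rw [im_ofReal_mul, I_im, mul_one]
  have h := ((summable_jacobiTheta₂_term_iff ((0 : ℝ) : ℂ) (((c / π : ℝ) : ℂ) * I)).2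
    (by rw [him]; positivity)).norm
  refine h.congr fun k => ?_
  rw [norm_jacobiTheta₂_term_ofReal, him, mul_div_cancel₀ _ Real.pi_ne_zero]

theorem norm_jacobiTheta₂_ofReal_le (t : ℝ) {z : ℂ} (hz : 0 < z.im) :
    ‖jacobiTheta₂ t z‖ ≤ ∑' k : ℤ, Real.exp (-(π * z.im * (k : ℝ) ^ 2)) := by
  have h := ((summable_jacobiTheta₂_term_iff (t : ℂ) z).2 hz).norm
  refine (norm_tsum_le_tsum_norm h).trans (le_of_eq ?_)
  simp only [norm_jacobiTheta₂_term_ofReal]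

theorem thetaThree_mul_I (y : ℝ) :
    thetaThree (y * I) = ((∑' k : ℤ, Real.exp (-(π * y * (k : ℝ) ^ 2)) : ℝ) : ℂ) := by
  rw [thetaThree, jacobiTheta₂, Complex.ofReal_tsum]
  refine tsum_congr fun k => ?_
  rw [jacobiTheta₂_term, Complex.ofReal_exp]
  congr 1
  push_cast
  linear_combination ((π : ℂ) * k ^ 2 * y) * I_mul_I

theorem thetaTwo_mul_I (y : ℝ) :
    thetaTwo (y * I) = ((∑' k : ℤ, Real.exp (-(π * y * (k + 1 / 2 : ℝ) ^ 2)) : ℝ) : ℂ) := by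
  rw [thetaTwo, jacobiTheta₂, Complex.ofReal_tsum, ← tsum_mul_left]
  refine tsum_congr fun k => ?_
  rw [jacobiTheta₂_term, Complex.ofReal_exp, ← Complex.exp_add]
  congr 1
  push_cast
  linear_combination ((π : ℂ) * (k + 1 / 2) ^ 2 * y) * I_mul_I

theorem summable_norm_thetaTwo_term {z : ℂ} (hz : 0 < z.im) :
    Summable fun k : ℤ => Real.exp (-(π * z.im * (k + 1 / 2 : ℝ) ^ 2)) := by
  have h := (((summable_jacobiTheta₂_term_iff (z / 2) z).2 hz).mul_left
    (cexp (π * I * z / 4))).norm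
  simpa only [norm_thetaTwo_term] using h

theorem norm_thetaTwo_le {z : ℂ} (hz : 0 < z.im) :
    ‖thetaTwo z‖ ≤ ∑' k : ℤ, Real.exp (-(π * z.im * (k + 1 / 2 : ℝ) ^ 2)) := by
  have h := (((summable_jacobiTheta₂_term_iff (z / 2) z).2 hz).mul_left
    (cexp (π * I * z / 4))).norm
  rw [thetaTwo, jacobiTheta₂, ← tsum_mul_left]
  refine (norm_tsum_le_tsum_norm h).trans (le_of_eq ?_)
  simp only [norm_thetaTwo_term]

theorem neg_one_div_inv_mul_I {y : ℝ} (hy : y ≠ 0) :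
    -1 / (((y⁻¹ : ℝ) : ℂ) * I) = (y : ℂ) * I := by
  have : (y : ℂ) ≠ 0 := by exact_mod_cast hy
  have hI := I_ne_zero
  push_cast
  field_simp
  rw [I_sq]

theorem tsum_exp_neg_mul_sq_le {y : ℝ} (hy : 0 < y) (hy1 : y ≤ 1) :
    ∑' k : ℤ, Real.exp (-(π * y⁻¹ * (k : ℝ) ^ 2)) ≤ ∑' k : ℤ, Real.exp (-(π * (k : ℝ) ^ 2)) := by
  have hinv := inv_pos.2 hy
  refine Summable.tsum_le_tsum (fun k => ?_) (summable_exp_neg_mul_sq (by positivity))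
    (summable_exp_neg_mul_sq (by positivity))
  have : π ≤ π * y⁻¹ := le_mul_of_one_le_right Real.pi_pos.le ((one_le_inv₀ hy).2 hy1)
  gcongr

/-- The absolute values of the terms sum to θ₃(i Im z); inversion rewrites this as (Im z)^(-1/2)
θ₃(i/Im z), and θ₃(i/Im z) ≤ θ₃(i). -/
theorem norm_jacobiTheta₂_ofReal_growth (t : ℝ) {z : ℂ} (hz : 0 < z.im) (hz1 : z.im ≤ 1) :
    ‖jacobiTheta₂ t z‖ ≤ (∑' k : ℤ, Real.exp (-(π * (k : ℝ) ^ 2))) * (√z.im)⁻¹ := by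
  have hinv := inv_pos.2 hz
  refine (norm_jacobiTheta₂_ofReal_le t hz).trans ?_
  have h1 := thetaThree_mul_I z.im
  have h2 := thetaThree_neg_one_div (z := ((z.im⁻¹ : ℝ) : ℂ) * I) (by simpa using hz)
  rw [neg_one_div_inv_mul_I hz.ne', h1, thetaThree_mul_I] at h2
  have h3 := congrArg norm h2
  rw [norm_mul, norm_neg_I_mul_cpow_half hinv, norm_real, norm_real,
    Real.norm_of_nonneg (tsum_nonneg fun _ => (Real.exp_pos _).le),
    Real.norm_of_nonneg (tsum_nonneg fun _ => (Real.exp_pos _).le), Real.sqrt_inv] at h3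
  rw [h3, mul_comm]
  exact mul_le_mul_of_nonneg_right (tsum_exp_neg_mul_sq_le hz hz1) (by positivity)

theorem norm_thetaTwo_growth {z : ℂ} (hz : 0 < z.im) (hz1 : z.im ≤ 1) :
    ‖thetaTwo z‖ ≤ (∑' k : ℤ, Real.exp (-(π * (k : ℝ) ^ 2))) * (√z.im)⁻¹ := by
  have hinv := inv_pos.2 hz
  refine (norm_thetaTwo_le hz).trans ?_
  have h1 := thetaTwo_mul_I z.im
  have hw : 0 < (((z.im⁻¹ : ℝ) : ℂ) * I).im := by simpa using hz
  have h2 := thetaTwo_neg_one_div hw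
  rw [neg_one_div_inv_mul_I hz.ne', h1] at h2
  have h3 := congrArg norm h2
  rw [norm_mul, norm_neg_I_mul_cpow_half hinv, norm_real,
    Real.norm_of_nonneg (tsum_nonneg fun _ => (Real.exp_pos _).le), Real.sqrt_inv] at h3
  have h4 := norm_jacobiTheta₂_ofReal_le (1 / 2) hw
  have h5 : (((z.im⁻¹ : ℝ) : ℂ) * I).im = z.im⁻¹ := by simp
  rw [h5] at h4
  push_cast at h4
  rw [h3, mul_comm]
  refine mul_le_mul_of_nonneg_right (le_trans ?_ (tsum_exp_neg_mul_sq_le hz hz1)) (by positivity)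
  exact_mod_cast h4

theorem isThetaForm_thetaThree : IsThetaForm 1 thetaThree where
  diff := differentiableOn_thetaThree
  add_two z _ := thetaThree_add_two z
  neg_one_div z hz := by rw [thetaThree_neg_one_div hz, pow_one]
  growth := ⟨_, tsum_nonneg fun _ => (Real.exp_pos _).le, fun z hz hz1 => by
    simpa [thetaThree] using norm_jacobiTheta₂_ofReal_growth 0 hz hz1⟩

theorem norm_thetaFour_growth {z : ℂ} (hz : 0 < z.im) (hz1 : z.im ≤ 1) :
    ‖thetaFour z‖ ≤ (∑' k : ℤ, Real.exp (-(π * (k : ℝ) ^ 2))) * (√z.im)⁻¹ := by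
  have := norm_jacobiTheta₂_ofReal_growth (1 / 2) hz hz1
  push_cast at this
  exact this

/-- Inversion swaps θ₂ and θ₄, so symmetric expressions are preserved; fourth powers remove the
factor i that θ₂ acquires under z ↦ z + 2. -/
theorem isThetaForm_thetaTwo_pow_mul_thetaFour_pow :
    IsThetaForm 8 fun z => thetaTwo z ^ 4 * thetaFour z ^ 4 where
  diff := (differentiableOn_thetaTwo.pow 4).mul (differentiableOn_thetaFour.pow 4)
  add_two z _ := by rw [thetaTwo_add_two, thetaFour_add_two, mul_pow, I_pow_four, one_mul]
  neg_one_div z hz := by rw [thetaTwo_neg_one_div hz, thetaFour_neg_one_div hz]; ring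
  growth := by
    refine ⟨(∑' k : ℤ, Real.exp (-(π * (k : ℝ) ^ 2))) ^ 8,
      pow_nonneg (tsum_nonneg fun _ => (Real.exp_pos _).le) _, fun z hz hz1 => ?_⟩
    have h1 := pow_le_pow_left₀ (norm_nonneg _) (norm_thetaTwo_growth hz hz1) 4
    have h2 := pow_le_pow_left₀ (norm_nonneg _) (norm_thetaFour_growth hz hz1) 4
    rw [norm_mul, norm_pow, norm_pow]
    refine (mul_le_mul h1 h2 (by positivity) ((pow_nonneg (norm_nonneg _) 4).trans h1)).trans
      (le_of_eq ?_)
    ring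

theorem isThetaForm_thetaTwo_pow_add_thetaFour_pow :
    IsThetaForm 4 fun z => thetaTwo z ^ 4 + thetaFour z ^ 4 where
  diff := (differentiableOn_thetaTwo.pow 4).add (differentiableOn_thetaFour.pow 4)
  add_two z _ := by rw [thetaTwo_add_two, thetaFour_add_two, mul_pow, I_pow_four, one_mul]
  neg_one_div z hz := by rw [thetaTwo_neg_one_div hz, thetaFour_neg_one_div hz]; ring
  growth := by
    refine ⟨2 * (∑' k : ℤ, Real.exp (-(π * (k : ℝ) ^ 2))) ^ 4,
      mul_nonneg two_pos.le (pow_nonneg (tsum_nonneg fun _ => (Real.exp_pos _).le) _),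
      fun z hz hz1 => ?_⟩
    have h1 := pow_le_pow_left₀ (norm_nonneg _) (norm_thetaTwo_growth hz hz1) 4
    have h2 := pow_le_pow_left₀ (norm_nonneg _) (norm_thetaFour_growth hz hz1) 4
    refine (norm_add_le _ _).trans ?_
    rw [norm_pow, norm_pow, mul_assoc, ← mul_pow, two_mul]
    exact add_le_add h1 h2

/-! ### Leading terms at i∞, Jacobi's identity and the difference of theta series -/

/-- `f` is `c + O(q)` at `i∞`, where `q = exp (π i z)`. -/
def IsConstAddBigO (f : ℂ → ℂ) (c : ℂ) : Prop :=
  (fun z => f z - c) =O[comap Complex.im atTop] fun z => Real.exp (-π * z.im)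

theorem exp_neg_pi_mul_im_isBigO_one :
    (fun z : ℂ => Real.exp (-π * z.im)) =O[comap Complex.im atTop] fun _ => (1 : ℝ) := by
  refine IsBigO.of_bound 1 ?_
  filter_upwards [eventually_im_ge 0] with z hz
  rw [Real.norm_of_nonneg (Real.exp_pos _).le, norm_one, mul_one, Real.exp_le_one_iff]
  nlinarith [Real.pi_pos]

namespace IsConstAddBigO

variable {f g : ℂ → ℂ} {c d : ℂ}

theorem mul (hf : IsConstAddBigO f c) (hg : IsConstAddBigO g d) :
    IsConstAddBigO (fun z => f z * g z) (c * d) := by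
  have h1 : (fun z => (f z - c) * (g z - d)) =O[comap Complex.im atTop]
      fun z => Real.exp (-π * z.im) := by
    simpa using IsBigO.mul hf (hg.trans exp_neg_pi_mul_im_isBigO_one)
  have h2 := (h1.add (IsBigO.const_mul_left hg c)).add (IsBigO.const_mul_left hf d)
  refine h2.congr_left fun z => ?_
  ring

theorem const (c : ℂ) : IsConstAddBigO (fun _ => c) c := by
  simp only [IsConstAddBigO, sub_self]
  exact isBigO_zero _ _

theorem pow (hf : IsConstAddBigO f c) (k : ℕ) : IsConstAddBigO (fun z => f z ^ k) (c ^ k) := by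
  induction k with
  | zero => simpa using const 1
  | succ k ih => simpa only [pow_succ] using ih.mul hf

theorem isBigO_one (hf : IsConstAddBigO f c) : f =O[comap Complex.im atTop] fun _ => (1 : ℝ) := by
  have := (IsBigO.trans hf exp_neg_pi_mul_im_isBigO_one).add
    (isBigO_const_const c (one_ne_zero (α := ℝ)) (comap Complex.im atTop))
  simpa using this

end IsConstAddBigO

theorem norm_cexp_pi_mul_I (z : ℂ) : ‖cexp (π * I * z)‖ = Real.exp (-π * z.im) := by
  rw [Complex.norm_exp, mul_assoc, re_ofReal_mul, I_mul_re]
  congr 1; ring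

theorem cexp_pi_mul_I_isBigO : (fun z : ℂ => cexp (π * I * z)) =O[comap Complex.im atTop]
    fun z => Real.exp (-π * z.im) :=
  IsBigO.of_bound 1 (Eventually.of_forall fun z => by
    rw [norm_cexp_pi_mul_I, Real.norm_of_nonneg (Real.exp_pos _).le, one_mul])

theorem isConstAddBigO_jacobiTheta₂_ofReal (t : ℝ) :
    IsConstAddBigO (fun z => jacobiTheta₂ t z) 1 := by
  have h := isBigO_tsum_sub_sum (s := {(0 : ℤ)}) (r := 1) (e := fun k : ℤ => (k : ℝ) ^ 2)
    (f := fun k z => jacobiTheta₂_term k t z)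
    (fun k z _ => norm_jacobiTheta₂_term_ofReal k t z)
    (fun k hk => by
      have hk0 : k ≠ 0 := by simpa using hk
      have : 0 < k ^ 2 := by positivity
      exact_mod_cast this)
    (fun c hc => summable_exp_neg_mul_sq hc)
  have h0 : ∀ z : ℂ, ∑ k ∈ {(0 : ℤ)}, jacobiTheta₂_term k t z = 1 := fun z => by
    simp [jacobiTheta₂_term]
  simp only [h0, pow_one] at h
  exact h

theorem isConstAddBigO_thetaThree : IsConstAddBigO thetaThree 1 := by
  have := isConstAddBigO_jacobiTheta₂_ofReal 0
  push_cast at this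
  exact this

theorem isConstAddBigO_thetaFour : IsConstAddBigO thetaFour 1 := by
  have := isConstAddBigO_jacobiTheta₂_ofReal (1 / 2)
  push_cast at this
  exact this

theorem summable_exp_neg_mul_sq_add {c : ℝ} (hc : 0 < c) :
    Summable fun k : ℤ => Real.exp (-(c * ((k : ℝ) ^ 2 + k))) := by
  have him : (((c / π : ℝ) : ℂ) * I).im = c / π := by rw [im_ofReal_mul, I_im, mul_one]
  have h := (summable_norm_thetaTwo_term (z := ((c / π : ℝ) : ℂ) * I)
    (by rw [him]; positivity)).mul_left (Real.exp (c / 4))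
  refine h.congr fun k => ?_
  rw [him, mul_div_cancel₀ _ Real.pi_ne_zero, ← Real.exp_add]
  congr 1; ring

/-- The exponents are k² + k, which is 0 exactly for k = 0 and k = -1; these two terms make the
constant 2. -/
theorem isConstAddBigO_jacobiTheta₂_half : IsConstAddBigO (fun z => jacobiTheta₂ (z / 2) z) 2 := by
  have h := isBigO_tsum_sub_sum (s := {(0 : ℤ), -1}) (r := 1)
    (e := fun k : ℤ => (k : ℝ) ^ 2 + k) (f := fun k z => jacobiTheta₂_term k (z / 2) z)
    (fun k z _ => by
      rw [norm_jacobiTheta₂_term]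
      congr 1
      have h2 : (z / 2).im = z.im / 2 := by
        rw [show z / 2 = z / ((2 : ℝ) : ℂ) by norm_num, Complex.div_ofReal_im]
      rw [h2]; ring)
    (fun k hk => by
      simp only [Finset.mem_insert, Finset.mem_singleton, not_or] at hk
      have : 1 ≤ k ^ 2 + k := by
        rcases lt_or_gt_of_ne hk.1 with h | h
        · have : k ≤ -2 := by omega
          nlinarith
        · nlinarith
      exact_mod_cast this)
    (fun c hc => summable_exp_neg_mul_sq_add hc)
  have h1 : ∀ z : ℂ, ∑ k ∈ {(0 : ℤ), -1}, jacobiTheta₂_term k (z / 2) z = 2 := by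
    intro z
    rw [Finset.sum_pair (by norm_num), jacobiTheta₂_term, jacobiTheta₂_term]
    push_cast
    have : (2 * π * I * -1 * (z / 2) + π * I * (-1) ^ 2 * z : ℂ) = 0 := by ring
    rw [this]
    simp
    norm_num
  simp only [h1, pow_one] at h
  exact h

theorem thetaTwo_pow_four (z : ℂ) :
    thetaTwo z ^ 4 = cexp (π * I * z) * jacobiTheta₂ (z / 2) z ^ 4 := by
  rw [thetaTwo, mul_pow, ← Complex.exp_nat_mul]
  congr 2
  push_cast; ring

/-- Jacobi's identity. -/
theorem thetaTwo_pow_add_thetaFour_pow {z : ℂ} (hz : 0 < z.im) :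
    thetaTwo z ^ 4 + thetaFour z ^ 4 = thetaThree z ^ 4 := by
  -- Both sides are theta forms of index 4 < 8, so it suffices that the difference is O(q): θ₂⁴ is
  -- O(q), while θ₃⁴ and θ₄⁴ are both 1 + O(q).
  have hform := isThetaForm_thetaTwo_pow_add_thetaFour_pow.sub (isThetaForm_thetaThree.pow 4)
  have h1 : (fun z => thetaTwo z ^ 4) =O[comap Complex.im atTop]
      fun z => Real.exp (-π * z.im) := by
    simp only [thetaTwo_pow_four]
    simpa using cexp_pi_mul_I_isBigO.mul (isConstAddBigO_jacobiTheta₂_half.pow 4).isBigO_one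
  have h2 := h1.add ((isConstAddBigO_thetaFour.pow 4).sub (isConstAddBigO_thetaThree.pow 4))
  refine sub_eq_zero.1 (hform.eq_zero (k := 1) (by norm_num) ?_ hz)
  refine (h2.congr_left fun z => ?_).congr_right fun z => ?_
  · ring
  · rw [pow_one]

/-- The modular form `Δ₈ = θ₂⁴ θ₄⁴ / 16` for the theta group. -/
noncomputable def deltaEight (z : ℂ) : ℂ := 16⁻¹ * (thetaTwo z ^ 4 * thetaFour z ^ 4)

theorem isThetaForm_deltaEight : IsThetaForm 8 deltaEight :=
  isThetaForm_thetaTwo_pow_mul_thetaFour_pow.const_mul _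

theorem deltaEight_eq (z : ℂ) : deltaEight z =
    cexp (π * I * z) * (16⁻¹ * (jacobiTheta₂ (z / 2) z ^ 4 * thetaFour z ^ 4)) := by
  rw [deltaEight, thetaTwo_pow_four]; ring

theorem isThetaForm_thetaThree_pow_mul_deltaEight_pow {m : ℕ} (hm : 8 * m ≤ n) :
    IsThetaForm n fun z => thetaThree z ^ (n - 8 * m) * deltaEight z ^ m := by
  have h := (isThetaForm_thetaThree.pow (n - 8 * m)).mul (isThetaForm_deltaEight.pow m)
  rwa [one_mul, Nat.sub_add_cancel hm] at h

theorem thetaThree_pow_mul_deltaEight_pow_sub_isBigO (k m : ℕ) :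
    (fun z => thetaThree z ^ k * deltaEight z ^ m - cexp (π * I * z) ^ m)
      =O[comap Complex.im atTop] fun z => Real.exp (-π * z.im) ^ (m + 1) := by
  have h1 := (isConstAddBigO_thetaThree.pow k).mul (((IsConstAddBigO.const 16⁻¹).mul
    ((isConstAddBigO_jacobiTheta₂_half.pow 4).mul (isConstAddBigO_thetaFour.pow 4))).pow m)
  -- As θ₂⁴ = q(2 + O(q))⁴, the factor 1/16 in Δ₈ makes the leading coefficient 1.
  have hc : (1 : ℂ) ^ k * (16⁻¹ * (2 ^ 4 * 1 ^ 4)) ^ m = 1 := by norm_num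
  rw [hc] at h1
  refine ((cexp_pi_mul_I_isBigO.pow m).mul h1).congr (fun z => ?_) (fun z => ?_)
  · simp only [deltaEight_eq, mul_pow]
    ring
  · rw [pow_succ]

/-- The theta series of two unimodular lattices whose shortest vectors have the largest length for
which this does not determine the theta series differ by the number of shortest vectors. -/
theorem IsUnimodular.theta_sub_theta {Λ Λ' : Submodule ℤ (Space n)} [DiscreteTopology Λ]
    [IsZLattice ℝ Λ] [DiscreteTopology Λ'] [IsZLattice ℝ Λ'] (hΛ : IsUnimodular Λ)
    (hΛ' : IsUnimodular Λ') {m : ℕ} (hm : 1 ≤ m) (hmn : 8 * m ≤ n) (hnm : n < 8 * (m + 1))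
    (hmin : IsShortestLength Λ m) (hmin' : IsShortestLength Λ' m) {z : ℂ} (hz : 0 < z.im) :
    theta Λ z - theta Λ' z = (numVectors Λ m - numVectors Λ' m) *
      (thetaThree z ^ (n - 8 * m) * deltaEight z ^ m) := by
  have hform := (hΛ.isThetaForm.sub hΛ'.isThetaForm).sub
    ((isThetaForm_thetaThree_pow_mul_deltaEight_pow hmn).const_mul
      (numVectors Λ m - numVectors Λ' m))
  refine sub_eq_zero.1 (hform.eq_zero hnm ?_ hz)
  -- The constant terms cancel between the theta series, and the q^m terms cancel against the
  -- multiple of θ₃^(n-8m) Δ₈^m.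
  have h := ((hΛ.theta_sub_isBigO hm hmin).sub (hΛ'.theta_sub_isBigO hm hmin')).sub
    ((thetaThree_pow_mul_deltaEight_pow_sub_isBigO (n - 8 * m) m).const_mul_left
      (numVectors Λ m - numVectors Λ' m : ℂ))
  refine h.congr_left fun z => ?_
  ring

/-! ### Values at i and positivity on the imaginary axis -/

theorem thetaTwo_I : thetaTwo I = thetaFour I := by
  have h := thetaTwo_neg_one_div (z := I) (by simp)
  have h1 : -1 / I = I := by rw [div_eq_iff I_ne_zero, I_mul_I]
  have h2 : -I * I = 1 := by rw [neg_mul, I_mul_I, neg_neg]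
  rwa [h1, h2, one_cpow, one_mul] at h

/-- Since θ₂(i) = θ₄(i), Jacobi's identity makes both fourth powers equal to θ₃(i)⁴/2, and 16 · 2² =
64. -/
theorem deltaEight_I : deltaEight I = thetaThree I ^ 8 / 64 := by
  have h := thetaTwo_pow_add_thetaFour_pow (z := I) (by simp)
  rw [deltaEight, thetaTwo_I]
  rw [thetaTwo_I] at h
  rw [show thetaThree I ^ 8 = (thetaThree I ^ 4) ^ 2 by ring, ← h]
  ring

theorem thetaThree_mul_I_pos {y : ℝ} (hy : 0 < y) : ∃ r : ℝ, 0 < r ∧ thetaThree (y * I) = r :=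
  ⟨_, (summable_exp_neg_mul_sq (by positivity)).tsum_pos (fun _ => (Real.exp_pos _).le) 0
    (Real.exp_pos _), thetaThree_mul_I y⟩

theorem thetaTwo_mul_I_pos {y : ℝ} (hy : 0 < y) : ∃ r : ℝ, 0 < r ∧ thetaTwo (y * I) = r :=
  ⟨_, Summable.tsum_pos (by
      simpa using summable_norm_thetaTwo_term (z := y * I) (by simpa using hy))
    (fun _ => (Real.exp_pos _).le) 0 (Real.exp_pos _), thetaTwo_mul_I y⟩

/-- The series of θ₄ alternates, so positivity is transported from θ₂ by inversion. -/
theorem thetaFour_mul_I_pos {y : ℝ} (hy : 0 < y) : ∃ r : ℝ, 0 < r ∧ thetaFour (y * I) = r := by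
  have hinv := inv_pos.2 hy
  obtain ⟨r, hr, h2⟩ := thetaTwo_mul_I_pos hinv
  have h := thetaFour_neg_one_div (z := ((y⁻¹ : ℝ) : ℂ) * I) (by simpa using hy)
  have h1 : -I * (((y⁻¹ : ℝ) : ℂ) * I) = ((y⁻¹ : ℝ) : ℂ) := by
    linear_combination (-((y⁻¹ : ℝ) : ℂ)) * I_mul_I
  rw [neg_one_div_inv_mul_I hy.ne', h1, h2] at h
  refine ⟨y⁻¹ ^ (1 / 2 : ℝ) * r, by positivity, ?_⟩
  rw [h, ofReal_mul, ofReal_cpow hinv.le]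
  norm_num

theorem deltaEight_mul_I_pos {y : ℝ} (hy : 0 < y) : ∃ r : ℝ, 0 < r ∧ deltaEight (y * I) = r := by
  obtain ⟨a, ha, h2⟩ := thetaTwo_mul_I_pos hy
  obtain ⟨b, hb, h4⟩ := thetaFour_mul_I_pos hy
  refine ⟨16⁻¹ * (a ^ 4 * b ^ 4), by positivity, ?_⟩
  rw [deltaEight, h2, h4]
  push_cast; ring

/-! ### The cubic lattice -/

theorem cubicLattice_eq_span (n : ℕ) : cubicLattice n =
    Submodule.span ℤ (Set.range (EuclideanSpace.basisFun (Fin n) ℝ).toBasis) := by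
  rw [cubicLattice, OrthonormalBasis.coe_toBasis]

instance instDiscreteTopologyCubicLattice (n : ℕ) : DiscreteTopology (cubicLattice n) := by
  rw [cubicLattice_eq_span]; infer_instance

instance instIsZLatticeCubicLattice (n : ℕ) : IsZLattice ℝ (cubicLattice n) where
  span_top := by
    rw [cubicLattice_eq_span]
    exact IsZLattice.span_top

theorem mem_cubicLattice {x : Space n} : x ∈ cubicLattice n ↔ ∀ i, ∃ k : ℤ, (k : ℝ) = x i := by
  rw [cubicLattice_eq_span, Module.Basis.mem_span_iff_repr_mem]
  simp

/-- Integer vectors are the points of the cubic lattice. -/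
noncomputable def intVectorEquiv (n : ℕ) : (Fin n → ℤ) ≃ cubicLattice n :=
  Equiv.ofBijective
    (fun k => ⟨WithLp.toLp 2 fun i => (k i : ℝ), mem_cubicLattice.2 fun i => ⟨k i, rfl⟩⟩) <| by
    refine ⟨fun k l h => ?_, fun ⟨x, hx⟩ => ?_⟩
    · funext i
      have := congrArg (fun x : cubicLattice n => (x : Space n) i) h
      simpa using this
    · choose k hk using mem_cubicLattice.1 hx
      refine ⟨k, Subtype.ext ?_⟩
      ext i
      simp [hk]

theorem norm_sq_intVectorEquiv (k : Fin n → ℤ) :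
    ‖(intVectorEquiv n k : Space n)‖ ^ 2 = ∑ i, (k i : ℝ) ^ 2 := by
  rw [EuclideanSpace.real_norm_sq_eq]
  rfl

theorem tsum_prod_fin {ι : Type*} {f : ι → ℂ} (hf : Summable fun i => ‖f i‖) (n : ℕ) :
    (Summable fun k : Fin n → ι => ‖∏ i, f (k i)‖) ∧
      ∑' k : Fin n → ι, ∏ i, f (k i) = (∑' i, f i) ^ n := by
  induction n with
  | zero => exact ⟨Summable.of_finite, by simp⟩
  | succ n ih =>
    have hs := hf.mul_norm ih.1
    have he : ∀ p : ι × (Fin n → ι),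
        ∏ i, f (Fin.consEquiv (fun _ => ι) p i) = f p.1 * ∏ i, f (p.2 i) := by
      intro p
      simp [Fin.prod_univ_succ, Fin.consEquiv]
    constructor
    · rw [← (Fin.consEquiv fun _ => ι).summable_iff]
      refine hs.congr fun p => ?_
      rw [Function.comp_apply, he]
    · rw [← (Fin.consEquiv fun _ => ι).tsum_eq]
      simp only [he]
      rw [pow_succ', ← ih.2, tsum_mul_tsum_of_summable_norm hf ih.1]

theorem theta_cubicLattice {z : ℂ} (hz : 0 < z.im) :
    theta (cubicLattice n) z = thetaThree z ^ n := by
  have hs := ((summable_jacobiTheta₂_term_iff 0 z).2 hz).norm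
  rw [thetaThree, jacobiTheta₂, ← (tsum_prod_fin hs n).2, theta, ← (intVectorEquiv n).tsum_eq]
  refine tsum_congr fun k => ?_
  rw [norm_sq_intVectorEquiv, Finset.prod_congr rfl fun i _ => jacobiTheta₂_term.eq_1 _ _ _,
    ← Complex.exp_sum]
  congr 1
  push_cast
  rw [Finset.mul_sum, Finset.sum_mul]
  exact Finset.sum_congr rfl fun i _ => by ring

theorem single_mem_cubicLattice (i : Fin n) (k : ℤ) :
    EuclideanSpace.single i (k : ℝ) ∈ cubicLattice n := by
  classical
  refine mem_cubicLattice.2 fun j => ?_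
  by_cases h : j = i
  · exact ⟨k, by simp [h]⟩
  · exact ⟨0, by simp [h]⟩

theorem isUnimodular_cubicLattice (n : ℕ) : IsUnimodular (cubicLattice n) where
  integral x hx y hy := by
    choose k hk using mem_cubicLattice.1 hx
    choose l hl using mem_cubicLattice.1 hy
    refine ⟨∑ i, l i * k i, ?_⟩
    rw [PiLp.inner_apply]
    push_cast
    refine Finset.sum_congr rfl fun i _ => ?_
    rw [hk, hl]
    simp [mul_comm]
  det_gram := by
    let e : (Fin n → ℤ) ≃+ cubicLattice n := AddEquiv.mk' (intVectorEquiv n) fun k l => by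
      apply Subtype.ext
      ext i
      exact Int.cast_add (k i) (l i)
    refine ⟨Module.Basis.ofEquivFun e.symm.toIntLinearEquiv, ?_⟩
    have h : ∀ i, ((Module.Basis.ofEquivFun e.symm.toIntLinearEquiv i : cubicLattice n) : Space n)
        = WithLp.toLp 2 fun j => ((Pi.single i 1 : Fin n → ℤ) j : ℝ) := by
      intro i
      rw [Module.Basis.coe_ofEquivFun]
      rfl
    have h1 : (Matrix.of fun i j : Fin n => (inner ℝ
        (WithLp.toLp 2 fun k => ((Pi.single i 1 : Fin n → ℤ) k : ℝ) : Space n)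
        (WithLp.toLp 2 fun k => ((Pi.single j 1 : Fin n → ℤ) k : ℝ) : Space n) : ℝ)) = 1 := by
      ext i j
      simp [PiLp.inner_apply, Matrix.one_apply, Pi.single_apply, eq_comm]
    simp only [h]
    rw [h1, Matrix.det_one, abs_one]

theorem isShortestLength_cubicLattice (hn : 0 < n) : IsShortestLength (cubicLattice n) 1 := by
  constructor
  · refine ⟨EuclideanSpace.single ⟨0, hn⟩ 1, ?_, ?_, ?_⟩
    · simpa using single_mem_cubicLattice (⟨0, hn⟩ : Fin n) 1
    · intro h
      have := congrArg norm h
      simp at this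
    · simp
  · rintro r ⟨x, hx, hx0, rfl⟩
    obtain ⟨k, hk⟩ := (isUnimodular_cubicLattice n).exists_norm_sq_eq ⟨x, hx⟩
    simp only at hk
    rw [hk]
    have : k ≠ 0 := by
      rintro rfl
      simp at hk
      exact hx0 hk
    exact_mod_cast Nat.one_le_iff_ne_zero.2 this

theorem finite_setOf_mem_norm_sq_eq (Λ : Submodule ℤ (Space n)) [DiscreteTopology Λ]
    [IsZLattice ℝ Λ] (r : ℝ) : {x : Space n | x ∈ Λ ∧ ‖x‖ ^ 2 = r}.Finite := by
  refine ((finite_norm_sq_eq Λ r).image Subtype.val).subset ?_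
  rintro x ⟨hx, hr⟩
  exact ⟨⟨x, hx⟩, hr, rfl⟩

theorem two_mul_le_numVectors_cubicLattice (n : ℕ) : 2 * n ≤ numVectors (cubicLattice n) 1 := by
  classical
  let f : Bool × Fin n → Space n := fun p =>
    EuclideanSpace.single p.2 (((bif p.1 then 1 else -1 : ℤ)) : ℝ)
  have hf : Function.Injective f := by
    rintro ⟨a, i⟩ ⟨b, j⟩ h
    have h1 := congrArg (fun x : Space n => x i) h
    have h2 := congrArg (fun x : Space n => x j) h
    by_cases hij : i = j
    · subst hij
      cases a <;> cases b <;> simp [f] at h1 ⊢ <;> norm_num at h1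
    · cases a <;> cases b <;> simp [f, hij] at h1
  have hsub : Set.range f ⊆ {x : Space n | x ∈ cubicLattice n ∧ ‖x‖ ^ 2 = ((1 : ℕ) : ℝ)} := by
    rintro _ ⟨⟨a, i⟩, rfl⟩
    refine ⟨single_mem_cubicLattice i _, ?_⟩
    cases a <;> simp [f]
  have h := Set.ncard_le_ncard hsub (finite_setOf_mem_norm_sq_eq (cubicLattice n) _)
  rwa [← Set.image_univ, Set.ncard_image_of_injective _ hf, Set.ncard_univ, Nat.card_prod,
    Nat.card_eq_fintype_card, Nat.card_eq_fintype_card, Fintype.card_bool, Fintype.card_fin] at h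

/-! ### The number of unit vectors in a unimodular lattice -/

theorem sum_inner_sq_le {S : Finset (Space n)} (hneg : ∀ x ∈ S, -x ∈ S)
    (hunit : ∀ x ∈ S, ‖x‖ = 1)
    (horth : ∀ x ∈ S, ∀ y ∈ S, y ≠ x → y ≠ -x → inner ℝ x y = (0 : ℝ)) (v : Space n) :
    ∑ x ∈ S, inner ℝ x v ^ 2 ≤ 2 * ‖v‖ ^ 2 := by
  classical
  -- Bessel's inequality. The set consists of orthogonal pairs ±x, so u is twice the projection of v
  -- onto its span; expanding ‖2v - u‖² ≥ 0 gives the bound.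
  set u : Space n := ∑ x ∈ S, (inner ℝ x v : ℝ) • x with hu
  have h1 : ∀ x ∈ S, inner ℝ x u = 2 * (inner ℝ x v : ℝ) := by
    intro x hx
    have hxx : inner ℝ x x = (1 : ℝ) := by rw [real_inner_self_eq_norm_sq, hunit x hx, one_pow]
    have hx0 : x ≠ -x := by
      intro h
      have : inner ℝ x x = -(inner ℝ x x : ℝ) := by
        conv_lhs => rw [h]
        rw [inner_neg_left, ← h]
      linarith
    rw [hu, inner_sum, ← Finset.sum_subset (s₁ := {x, -x}), Finset.sum_pair hx0]
    · simp only [inner_smul_right, inner_neg_left, inner_neg_right, hxx]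
      ring
    · intro y hy
      rw [Finset.mem_insert, Finset.mem_singleton] at hy
      rcases hy with rfl | rfl
      exacts [hx, hneg x hx]
    · intro y hy hy'
      rw [Finset.mem_insert, Finset.mem_singleton, not_or] at hy'
      rw [inner_smul_right, horth x hx y hy hy'.1 hy'.2, mul_zero]
  have h2 : inner ℝ u u = 2 * ∑ x ∈ S, (inner ℝ x v : ℝ) ^ 2 := by
    conv_lhs => rw [hu]
    rw [sum_inner, Finset.mul_sum]
    refine Finset.sum_congr rfl fun x hx => ?_
    rw [inner_smul_left, h1 x hx]
    simp only [conj_trivial]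
    ring
  have h3 : inner ℝ u v = ∑ x ∈ S, (inner ℝ x v : ℝ) ^ 2 := by
    rw [hu, sum_inner]
    refine Finset.sum_congr rfl fun x hx => ?_
    rw [inner_smul_left]
    simp only [conj_trivial]
    ring
  have h4 := sq_nonneg ‖2 • v - u‖
  rw [← real_inner_self_eq_norm_sq, inner_sub_left, inner_sub_right, inner_sub_right,
    real_inner_comm u (2 • v), h2, two_smul, inner_add_left, inner_add_right, inner_add_right,
    h3, real_inner_self_eq_norm_sq] at h4
  linarith

/-- Unit vectors of an integral lattice are equal, opposite or orthogonal, since their inner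
products are integers in [-1,1]. Summing Bessel's inequality over the standard basis counts each
unit vector once on the left and gives 2n on the right. -/
theorem IsUnimodular.numVectors_one_le {Λ : Submodule ℤ (Space n)} [DiscreteTopology Λ]
    [IsZLattice ℝ Λ] (hΛ : IsUnimodular Λ) : numVectors Λ 1 ≤ 2 * n := by
  classical
  set S := (finite_setOf_mem_norm_sq_eq Λ ((1 : ℕ) : ℝ)).toFinset with hS
  have hmem : ∀ x, x ∈ S ↔ x ∈ Λ ∧ ‖x‖ = 1 := by
    intro x
    rw [hS, Set.Finite.mem_toFinset, Set.mem_ofPred_eq, Nat.cast_one,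
      pow_eq_one_iff_of_nonneg (norm_nonneg x) two_ne_zero]
  have hcard : numVectors Λ 1 = S.card := by
    rw [numVectors, hS, Set.ncard_eq_toFinset_card _ (finite_setOf_mem_norm_sq_eq Λ _)]
  have hle := fun v => sum_inner_sq_le (S := S)
    (fun x hx => by rw [hmem] at hx ⊢; simpa using hx)
    (fun x hx => ((hmem x).1 hx).2)
    (fun x hx y hy hxy hxy' => by
      rw [hmem] at hx hy
      obtain ⟨k, hk⟩ := hΛ.integral x hx.1 y hy.1
      have h1 : inner ℝ x y ≠ (1 : ℝ) := fun h =>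
        hxy ((inner_eq_one_iff_of_norm_eq_one hx.2 hy.2).1 h).symm
      have h2 : inner ℝ x y ≠ (-1 : ℝ) := fun h => by
        have h3 : inner ℝ x (-y) = (1 : ℝ) := by rw [inner_neg_right, h, neg_neg]
        have h4 := (inner_eq_one_iff_of_norm_eq_one hx.2 (by rw [norm_neg, hy.2])).1 h3
        exact hxy' (by rw [h4, neg_neg])
      have h3 := abs_real_inner_le_norm x y
      rw [hx.2, hy.2, mul_one] at h3
      rw [hk] at h1 h2 h3 ⊢
      have h4 : |k| ≤ 1 := by exact_mod_cast h3
      have h5 : k ≠ 1 := by exact_mod_cast h1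
      have h6 : k ≠ -1 := by
        intro h; rw [h] at h2; norm_num at h2
      rw [abs_le] at h4
      have : k = 0 := by omega
      simp [this]) v
  have hsum : ∑ i : Fin n, ∑ x ∈ S, (inner ℝ x (EuclideanSpace.basisFun (Fin n) ℝ i) : ℝ) ^ 2
      = S.card := by
    rw [Finset.sum_comm, Finset.card_eq_sum_ones, Nat.cast_sum]
    refine Finset.sum_congr rfl fun x hx => ?_
    have := (EuclideanSpace.basisFun (Fin n) ℝ).sum_sq_norm_inner_left x
    rw [((hmem x).1 hx).2] at this
    simpa using this
  have h2 : (S.card : ℝ) ≤ 2 * n := by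
    rw [← hsum]
    refine (Finset.sum_le_sum fun i _ => hle _).trans (le_of_eq ?_)
    simp [mul_comm]
  rw [hcard]
  exact_mod_cast h2

/-! ### The secrecy function on the positive axis -/

/-- The theta series on the imaginary axis, as a real function. -/
noncomputable def realTheta (Λ : Submodule ℤ (Space n)) (y : ℝ) : ℝ :=
  ∑' x : Λ, Real.exp (-(π * y * ‖(x : Space n)‖ ^ 2))

theorem theta_mul_I_eq_realTheta (Λ : Submodule ℤ (Space n)) (y : ℝ) :
    theta Λ (y * I) = (realTheta Λ y : ℂ) :=
  theta_mul_I' Λ y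

theorem secrecyFunction_eq (Λ : Submodule ℤ (Space n)) (y : ℝ) :
    secrecyFunction Λ y = realTheta (cubicLattice n) y / realTheta Λ y := by
  rw [secrecyFunction, theta_mul_I_eq_realTheta, theta_mul_I_eq_realTheta, ← ofReal_div, ofReal_re]

theorem tendsto_mul_I_comap_im :
    Tendsto (fun y : ℝ => (y : ℂ) * I) atTop (comap Complex.im atTop) := by
  rw [tendsto_comap_iff]
  refine tendsto_id.congr fun y => ?_
  simp

theorem tendsto_exp_neg_pi_mul : Tendsto (fun y : ℝ => Real.exp (-π * y)) atTop (𝓝 0) :=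
  Real.tendsto_exp_atBot.comp (tendsto_id.const_mul_atTop_of_neg (by linarith [Real.pi_pos]))

section

variable (Λ : Submodule ℤ (Space n)) [DiscreteTopology Λ] [IsZLattice ℝ Λ]

theorem summable_realTheta {y : ℝ} (hy : 0 < y) :
    Summable fun x : Λ => Real.exp (-(π * y * ‖(x : Space n)‖ ^ 2)) :=
  summable_exp_neg_mul_norm_sq Λ (by positivity)

theorem realTheta_pos {y : ℝ} (hy : 0 < y) : 0 < realTheta Λ y :=
  (summable_realTheta Λ hy).tsum_pos (fun _ => (Real.exp_pos _).le) 0 (Real.exp_pos _)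

theorem continuousOn_realTheta : ContinuousOn (realTheta Λ) (Set.Ioi 0) := by
  have h1 : ContinuousOn (fun y : ℝ => theta Λ (y * I)) (Set.Ioi 0) :=
    (differentiableOn_theta Λ).continuousOn.comp (by fun_prop) fun y hy => by simpa using hy
  refine (continuous_re.comp_continuousOn h1).congr fun y _ => ?_
  rw [Function.comp_apply, theta_mul_I_eq_realTheta, ofReal_re]

theorem theta_sub_one_isBigO {r : ℕ} (hr : ∀ x ∈ Λ, x ≠ 0 → (r : ℝ) ≤ ‖x‖ ^ 2) :
    (fun z => theta Λ z - 1) =O[comap Complex.im atTop] fun z => Real.exp (-π * z.im) ^ r := by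
  have h := isBigO_tsum_sub_sum (s := {(0 : Λ)}) (r := r)
    (fun (x : Λ) z _ => norm_theta_term (x : Space n) z)
    (fun x hx => hr x x.2 (by simpa using hx))
    (fun c hc => summable_exp_neg_mul_norm_sq Λ hc)
  have h0 : ∀ z : ℂ, ∑ x ∈ {(0 : Λ)}, cexp (π * I * ((‖(x : Space n)‖ ^ 2 : ℝ) : ℂ) * z) = 1 :=
    fun z => by simp
  simp only [h0] at h
  exact h

theorem realTheta_sub_one_isBigO {r : ℕ} (hr : ∀ x ∈ Λ, x ≠ 0 → (r : ℝ) ≤ ‖x‖ ^ 2) :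
    (fun y => realTheta Λ y - 1) =O[atTop] fun y => Real.exp (-π * y) ^ r := by
  have h := ((theta_sub_one_isBigO Λ hr).comp_tendsto tendsto_mul_I_comap_im).norm_left
  rw [← isBigO_norm_left]
  refine h.congr (fun y => ?_) (fun y => ?_)
  · rw [Function.comp_apply, theta_mul_I_eq_realTheta, ← ofReal_one, ← ofReal_sub, norm_real]
  · simp

variable {Λ}

theorem IsUnimodular.tendsto_realTheta (hΛ : IsUnimodular Λ) :
    Tendsto (realTheta Λ) atTop (𝓝 1) := by
  have h := realTheta_sub_one_isBigO Λ (r := 1) fun x hx hx0 => by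
    obtain ⟨k, hk⟩ := hΛ.exists_norm_sq_eq ⟨x, hx⟩
    simp only at hk
    rw [hk]
    have : k ≠ 0 := by
      rintro rfl
      simp at hk
      exact hx0 hk
    exact_mod_cast Nat.one_le_iff_ne_zero.2 this
  have h2 := h.trans_tendsto (by simpa using tendsto_exp_neg_pi_mul)
  simpa using h2.add_const 1

/-- ℤⁿ is unimodular too, so the same automorphy factor appears in numerator and denominator. -/
theorem IsUnimodular.secrecyFunction_inv (hΛ : IsUnimodular Λ) {y : ℝ} (hy : 0 < y) :
    secrecyFunction Λ y⁻¹ = secrecyFunction Λ y := by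
  have hw : 0 < (((y⁻¹ : ℝ) : ℂ) * I).im := by simpa using hy
  have h1 := hΛ.theta_neg_one_div hw
  have h2 := (isUnimodular_cubicLattice n).theta_neg_one_div hw
  rw [neg_one_div_inv_mul_I hy.ne'] at h1 h2
  rw [secrecyFunction, secrecyFunction, h1, h2,
    mul_div_mul_left _ _ (pow_ne_zero _ (cpow_half_ne_zero hw))]

variable (Λ) in
theorem continuousOn_secrecyFunction : ContinuousOn (secrecyFunction Λ) (Set.Ioi 0) := by
  refine ((continuousOn_realTheta (cubicLattice n)).div (continuousOn_realTheta Λ)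
    fun y hy => (realTheta_pos Λ hy).ne').congr fun y _ => ?_
  rw [secrecyFunction_eq, Pi.div_apply]

theorem IsUnimodular.tendsto_secrecyFunction (hΛ : IsUnimodular Λ) :
    Tendsto (secrecyFunction Λ) atTop (𝓝 1) := by
  have h := (isUnimodular_cubicLattice n).tendsto_realTheta.div hΛ.tendsto_realTheta one_ne_zero
  rw [div_one] at h
  exact h.congr fun y => (secrecyFunction_eq Λ y).symm

end

theorem one_add_exp_le_realTheta_cubicLattice (hn : 0 < n) {y : ℝ} (hy : 0 < y) :
    1 + Real.exp (-π * y) ≤ realTheta (cubicLattice n) y := by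
  classical
  set u : cubicLattice n := ⟨EuclideanSpace.single ⟨0, hn⟩ 1, by
    simpa using single_mem_cubicLattice (⟨0, hn⟩ : Fin n) 1⟩ with hu
  have hu1 : ‖(u : Space n)‖ = 1 := by simp [hu]
  have hu0 : (0 : cubicLattice n) ≠ u := by
    intro h
    rw [← h] at hu1
    simp at hu1
  have h := (summable_realTheta (cubicLattice n) hy).sum_le_tsum {0, u}
    (fun _ _ => (Real.exp_pos _).le)
  rw [Finset.sum_pair hu0, hu1] at h
  refine le_trans (le_of_eq ?_) h
  simp

/-- A function on the positive reals that is invariant under inversion, tends to a limit at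
infinity and takes a value at least as large as the limit attains its maximum. -/
theorem exists_isMaxOn_Ioi {f : ℝ → ℝ} {l : ℝ} (hc : ContinuousOn f (Set.Ioi 0))
    (hinv : ∀ y, 0 < y → f y⁻¹ = f y) (hl : Tendsto f atTop (𝓝 l)) (hge : ∃ y, 0 < y ∧ l ≤ f y) :
    ∃ y, 0 < y ∧ IsMaxOn f (Set.Ioi 0) y := by
  -- If f never exceeds l, the given point is a maximiser. Otherwise a value above l occurs at some
  -- a ≥ 1 by inversion, f drops below it far out, and compactness applies on the remaining
  -- interval.
  by_cases h : ∀ y, 0 < y → f y ≤ l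
  · obtain ⟨y, hy, hly⟩ := hge
    exact ⟨y, hy, fun x hx => (h x hx).trans hly⟩
  · push Not at h
    have h1 : ∃ a, 1 ≤ a ∧ l < f a := by
      obtain ⟨a, ha, hla⟩ := h
      rcases le_total 1 a with h1 | h1
      · exact ⟨a, h1, hla⟩
      · exact ⟨a⁻¹, (one_le_inv₀ ha).2 h1, by rwa [hinv a ha]⟩
    obtain ⟨a, ha1, hla⟩ := h1
    obtain ⟨M, hM⟩ := eventually_atTop.1 (hl.eventually_lt_const hla)
    have hsub : Set.Icc 1 (max M a) ⊆ Set.Ioi 0 := fun x hx =>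
      lt_of_lt_of_le one_pos hx.1
    obtain ⟨b, hb, hmax⟩ := isCompact_Icc.exists_isMaxOn
      (Set.nonempty_Icc.2 (ha1.trans (le_max_right M a))) (hc.mono hsub)
    have hab : f a ≤ f b := hmax ⟨ha1, le_max_right _ _⟩
    have hIci : ∀ x, 1 ≤ x → f x ≤ f b := by
      intro x hx
      rcases le_total x (max M a) with h2 | h2
      · exact hmax ⟨hx, h2⟩
      · exact (hM x ((le_max_left _ _).trans h2)).le.trans hab
    refine ⟨b, hsub hb, fun x (hx : 0 < x) => ?_⟩
    rcases le_total 1 x with h2 | h2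
    · exact hIci x h2
    · change f x ≤ f b
      rw [← hinv x hx]
      exact hIci _ ((one_le_inv₀ hx).2 h2)

/-! ### Comparison of theta series and existence of the maximum -/

section

variable {Λ Λ' : Submodule ℤ (Space n)} [DiscreteTopology Λ] [IsZLattice ℝ Λ]
  [DiscreteTopology Λ'] [IsZLattice ℝ Λ'] {m : ℕ}

theorem IsUnimodular.realTheta_sub (hΛ : IsUnimodular Λ) (hΛ' : IsUnimodular Λ') (hm : 1 ≤ m)
    (hmn : 8 * m ≤ n) (hnm : n < 8 * (m + 1)) (hmin : IsShortestLength Λ m)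
    (hmin' : IsShortestLength Λ' m) {y : ℝ} (hy : 0 < y) :
    ∃ c : ℝ, 0 < c ∧
      realTheta Λ y - realTheta Λ' y = ((numVectors Λ m : ℝ) - numVectors Λ' m) * c := by
  have h := hΛ.theta_sub_theta hΛ' hm hmn hnm hmin hmin' (z := y * I) (by simpa using hy)
  obtain ⟨a, ha, h3⟩ := thetaThree_mul_I_pos hy
  obtain ⟨b, hb, h8⟩ := deltaEight_mul_I_pos hy
  refine ⟨a ^ (n - 8 * m) * b ^ m, by positivity, ?_⟩
  rw [theta_mul_I_eq_realTheta, theta_mul_I_eq_realTheta, h3, h8] at h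
  exact_mod_cast h

theorem IsUnimodular.realTheta_one_sub (hΛ : IsUnimodular Λ) (hΛ' : IsUnimodular Λ') (hm : 1 ≤ m)
    (hmn : 8 * m ≤ n) (hnm : n < 8 * (m + 1)) (hmin : IsShortestLength Λ m)
    (hmin' : IsShortestLength Λ' m) :
    realTheta Λ 1 - realTheta Λ' 1 =
      ((numVectors Λ m : ℝ) - numVectors Λ' m) / 4 ^ (3 * m) * realTheta (cubicLattice n) 1 := by
  have h := hΛ.theta_sub_theta hΛ' hm hmn hnm hmin hmin' (z := I) (by simp)
  have hI : (I : ℂ) = ((1 : ℝ) : ℂ) * I := by simp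
  have hz := theta_cubicLattice (n := n) (z := I) (by simp)
  rw [deltaEight_I, div_pow, ← pow_mul, ← mul_div_assoc, ← pow_add, Nat.sub_add_cancel hmn, ← hz,
    hI, theta_mul_I_eq_realTheta, theta_mul_I_eq_realTheta, theta_mul_I_eq_realTheta] at h
  have h4 : (4 : ℝ) ^ (3 * m) = 64 ^ m := by rw [pow_mul]; norm_num
  rw [h4, div_mul_eq_mul_div, mul_div_assoc]
  exact_mod_cast h

/-- For m = 1, ℤⁿ has the same shortest length and at least as many shortest vectors, so the
difference formula applied to Λ and ℤⁿ gives Θ_Λ ≤ Θ_{ℤⁿ}. For m ≥ 2, Θ_Λ - 1 is O(q²), eventually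
less than the term q in Θ_{ℤⁿ}. -/
theorem IsUnimodular.exists_one_le_secrecyFunction (hΛ : IsUnimodular Λ) (hm : 1 ≤ m)
    (hmn : 8 * m ≤ n) (hnm : n < 8 * (m + 1)) (hmin : IsShortestLength Λ m) :
    ∃ y, 0 < y ∧ 1 ≤ secrecyFunction Λ y := by
  suffices h : ∃ y, 0 < y ∧ realTheta Λ y ≤ realTheta (cubicLattice n) y by
    obtain ⟨y, hy, h⟩ := h
    exact ⟨y, hy, by rwa [secrecyFunction_eq, one_le_div (realTheta_pos Λ hy)]⟩
  have hn : 0 < n := by omega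
  rcases hm.eq_or_lt with rfl | hm2
  · refine ⟨1, one_pos, ?_⟩
    obtain ⟨c, hc, h⟩ := hΛ.realTheta_sub (isUnimodular_cubicLattice n) hm hmn hnm hmin
      (by simpa using isShortestLength_cubicLattice hn) one_pos
    have h1 : (numVectors Λ 1 : ℝ) ≤ numVectors (cubicLattice n) 1 := by
      exact_mod_cast hΛ.numVectors_one_le.trans (two_mul_le_numVectors_cubicLattice n)
    nlinarith
  · have h := realTheta_sub_one_isBigO Λ (r := 2) fun x hx hx0 => by
      have h1 : (m : ℝ) ≤ ‖x‖ ^ 2 := hmin.2 ⟨x, hx, hx0, rfl⟩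
      have h2 : (2 : ℝ) ≤ m := by exact_mod_cast hm2
      exact_mod_cast h2.trans h1
    have h2 : (fun y : ℝ => Real.exp (-π * y) ^ 2) =o[atTop] fun y => Real.exp (-π * y) ^ 1 :=
      (isLittleO_pow_pow one_lt_two).comp_tendsto tendsto_exp_neg_pi_mul
    have h3 := ((h.trans_isLittleO h2).bound one_pos).and (eventually_gt_atTop 0)
    obtain ⟨y, hy, hy0⟩ := h3.exists
    refine ⟨y, hy0, ?_⟩
    have h4 := one_add_exp_le_realTheta_cubicLattice hn hy0
    rw [one_mul, pow_one, Real.norm_of_nonneg (Real.exp_pos _).le] at hy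
    have h5 := (Real.le_norm_self _).trans hy
    linarith

theorem isGreatest_secrecyGain_of_isMaxOn {Λ : Submodule ℤ (Space n)} {y : ℝ} (hy : 0 < y)
    (h : IsMaxOn (secrecyFunction Λ) (Set.Ioi 0) y) :
    IsGreatest (secrecyFunction Λ '' Set.Ioi 0) (secrecyGain Λ) ∧
      secrecyGain Λ = secrecyFunction Λ y := by
  have hg : IsGreatest (secrecyFunction Λ '' Set.Ioi 0) (secrecyFunction Λ y) :=
    ⟨⟨y, hy, rfl⟩, by rintro _ ⟨x, hx, rfl⟩; exact h hx⟩
  have : secrecyGain Λ = secrecyFunction Λ y := hg.csSup_eq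
  exact ⟨this ▸ hg, this⟩

theorem IsUnimodular.isGreatest_secrecyGain (hΛ : IsUnimodular Λ) (hm : 1 ≤ m)
    (hmn : 8 * m ≤ n) (hnm : n < 8 * (m + 1)) (hmin : IsShortestLength Λ m) :
    IsGreatest (secrecyFunction Λ '' Set.Ioi 0) (secrecyGain Λ) := by
  obtain ⟨y, hy, h⟩ := exists_isMaxOn_Ioi (continuousOn_secrecyFunction Λ)
    (fun y hy => hΛ.secrecyFunction_inv hy) hΛ.tendsto_secrecyFunction
    (hΛ.exists_one_le_secrecyFunction hm hmn hnm hmin)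
  exact (isGreatest_secrecyGain_of_isMaxOn hy h).1

end

theorem IsShortestLength.pos {Λ : Submodule ℤ (Space n)} {m : ℕ}
    (hmin : IsShortestLength Λ m) : 0 < m := by
  obtain ⟨x, -, hx0, hx⟩ := hmin.1
  have : (0 : ℝ) < m := by rw [← hx]; positivity
  exact_mod_cast this

end

end SecrecyGain

/-! ### The main theorem -/

theorem mainTheorem4 (n : ℕ)
    (Λ Λ' : Submodule ℤ (SecrecyGain.Space n))
    [DiscreteTopology Λ] [IsZLattice ℝ Λ] [DiscreteTopology Λ'] [IsZLattice ℝ Λ']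
    (hΛ : SecrecyGain.IsOddUnimodular Λ) (hΛ' : SecrecyGain.IsOddUnimodular Λ')
    (hmin : SecrecyGain.IsShortestLength Λ (n / 8))
    (hmin' : SecrecyGain.IsShortestLength Λ' (n / 8)) :
    IsGreatest (SecrecyGain.secrecyFunction Λ '' Set.Ioi 0) (SecrecyGain.secrecyGain Λ) ∧
    IsGreatest (SecrecyGain.secrecyFunction Λ' '' Set.Ioi 0) (SecrecyGain.secrecyGain Λ') ∧
    (SecrecyGain.numVectors Λ' (n / 8) < SecrecyGain.numVectors Λ (n / 8) →
      SecrecyGain.secrecyGain Λ < SecrecyGain.secrecyGain Λ') ∧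
    (SecrecyGain.BelfioreSole Λ → SecrecyGain.BelfioreSole Λ' →
      (SecrecyGain.secrecyGain Λ)⁻¹ - (SecrecyGain.secrecyGain Λ')⁻¹ =
        ((SecrecyGain.numVectors Λ (n / 8) : ℝ) - (SecrecyGain.numVectors Λ' (n / 8) : ℝ)) /
          4 ^ (3 * (n / 8))) := by
  -- The shortest length belongs to a nonzero vector, which forces n ≥ 8.
  have hm : 1 ≤ n / 8 := hmin.pos
  have hmn : 8 * (n / 8) ≤ n := Nat.mul_div_le n 8
  have hnm : n < 8 * (n / 8 + 1) := Nat.lt_mul_div_succ n (by norm_num)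
  have hu := hΛ.unimodular
  have hu' := hΛ'.unimodular
  have hg := hu.isGreatest_secrecyGain hm hmn hnm hmin
  have hg' := hu'.isGreatest_secrecyGain hm hmn hnm hmin'
  refine ⟨hg, hg', fun hlt => ?_, fun hB hB' => ?_⟩
  -- At a maximiser y of Ξ_Λ one has χ_Λ = Ξ_Λ(y) < Ξ_Λ'(y) ≤ χ_Λ'; attainment is what keeps the
  -- inequality strict.
  · obtain ⟨y, hy, hgy⟩ := hg.1
    obtain ⟨c, hc, hsub⟩ := hu.realTheta_sub hu' hm hmn hnm hmin hmin' hy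
    have hpos : (0 : ℝ) < SecrecyGain.numVectors Λ (n / 8) - SecrecyGain.numVectors Λ' (n / 8) :=
      sub_pos.2 (by exact_mod_cast hlt)
    have hθ : SecrecyGain.realTheta Λ' y < SecrecyGain.realTheta Λ y :=
      sub_pos.1 (hsub ▸ mul_pos hpos hc)
    rw [← hgy]
    refine lt_of_lt_of_le ?_ (hg'.2 ⟨y, hy, rfl⟩)
    rw [SecrecyGain.secrecyFunction_eq, SecrecyGain.secrecyFunction_eq]
    exact div_lt_div_of_pos_left (SecrecyGain.realTheta_pos _ hy) (SecrecyGain.realTheta_pos Λ' hy)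
      hθ
  -- Both gains are values at y = 1, so their reciprocals share the denominator Θ_{ℤⁿ}(i).
  · rw [(SecrecyGain.isGreatest_secrecyGain_of_isMaxOn one_pos hB).2,
      (SecrecyGain.isGreatest_secrecyGain_of_isMaxOn one_pos hB').2, SecrecyGain.secrecyFunction_eq,
      SecrecyGain.secrecyFunction_eq, inv_div, inv_div, ← sub_div,
      hu.realTheta_one_sub hu' hm hmn hnm hmin hmin',
      mul_div_cancel_right₀ _ (SecrecyGain.realTheta_pos _ one_pos).ne']
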